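/- Let $n,p,m\ge 1$, $B^*\in\mathbb R^{p\times m}$ and $\sigma>0$. One observes $(X,Y)$ with $Y=\Pi^*XB^*+W$, where $\Pi^*$ is an unknown $n\times n$ permutation matrix, $X\in\mathbb R^{n\times p}$ has i.i.d. $N(0,1)$ entries, and $W\in\mathbb R^{n\times m}$, independent of $X$, has i.i.d. $N(0,\sigma^2)$ entries; $B^*$ and $\sigma$ are known. Let $\mathcal P_n$ be the set of $n\times n$ permutation matrices, and for $\Pi_1,\Pi_2\in\mathcal P_n$ with associated permutations $\pi_1,\pi_2$ let $d_H(\Pi_1;\Pi_2)=\sum_{i=1}^n \mathbb 1(\pi_1(i)\ne\pi_2(i))$. Below, $\mathbb E$ is taken with respect to $X$ and $W$, and the infima are over all estimators $\widehat\Pi$, i.e. all measurable functions of $(X,Y)$ with values in $\mathcal P_n$ (which may depend on $B^*$ and $\sigma$). (a) For every $D\in\{0,1,\dots,n\}$, $$\inf_{\widehat\Pi}\sup_{\Pi^*\in\mathcal P_n}\mathbb E\,\mathbb 1\big(d_H(\widehat\Pi;\Pi^*)\ge D\big)\ \ge\ \frac12\qquad\text{if}\qquad \log\det\Big(I+\frac{B^{*\top}B^*}{\sigma^2}\Big)\le\frac{\log\big((n-D+1)!\big)-\log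 4}{n}.$$ (b) Moreover, $$\inf_{\widehat\Pi}\sup_{\Pi^*\in\mathcal P_n}\mathbb E\,d_H(\widehat\Pi;\Pi^*)\ \ge\ \max_{d\in\{0,1,\dots,n-1\}}(d+1)\left(1-\frac{(n/2)\log\det\big(I+B^{*\top}B^*/\sigma^2\big)+\log 2}{\log\big((n-d+1)!\big)}\right).$$ -/

import Mathlib

open MeasureTheory ProbabilityTheory
open scoped ENNReal NNReal Nat

/-- Real `k × l` matrices carry the product (Borel) σ-algebra of their entries. -/
instance instMeasurableSpaceRealMatrix (k l : ℕ) : MeasurableSpace (Matrix (Fin k) (Fin l) ℝ) :=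
  inferInstanceAs (MeasurableSpace (Fin k → Fin l → ℝ))

/-- The law of a random `k × l` matrix whose entries are i.i.d. `N(0, v)`. -/
noncomputable def gaussianMatrix (k l : ℕ) (v : ℝ≥0) : Measure (Matrix (Fin k) (Fin l) ℝ) :=
  (Measure.pi fun _ : Fin k => Measure.pi fun _ : Fin l => gaussianReal 0 v).map Matrix.of

/-- The Hamming distance between two permutation matrices, expressed through the associated
permutations: the number of indices `i` with `π₁ i ≠ π₂ i`. -/
def permHamming {n : ℕ} (π₁ π₂ : Equiv.Perm (Fin n)) : ℕ :=
  ∑ i : Fin n, if π₁ i ≠ π₂ i then 1 else 0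

/-- The observed responses `Y = Π X B + W`, where `Π` is the permutation matrix of `π`
(row `j` of `Π X` is row `π j` of `X`). -/
noncomputable def response {n p m : ℕ} (B : Matrix (Fin p) (Fin m) ℝ) (π : Equiv.Perm (Fin n))
    (X : Matrix (Fin n) (Fin p) ℝ) (W : Matrix (Fin n) (Fin m) ℝ) :
    Matrix (Fin n) (Fin m) ℝ :=
  π.permMatrix ℝ * X * B + W

/-- An estimator of the permutation: a measurable map of the data `(X, Y)` into the (finite,
discrete) set of permutations. -/
structure PermEstimator (n p m : ℕ) where
  /-- the estimated permutation for given data `(X, Y)` -/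
  toFun : Matrix (Fin n) (Fin p) ℝ × Matrix (Fin n) (Fin m) ℝ → Equiv.Perm (Fin n)
  /-- measurability -/
  measurableSet_fiber : ∀ π : Equiv.Perm (Fin n), MeasurableSet (toFun ⁻¹' {π})

/-- The expected loss, over independent `X` with i.i.d. `N(0, 1)` entries and `W` with i.i.d.
`N(0, σ²)` entries, of an estimator when the true permutation is `π`. -/
noncomputable def permRisk {n p m : ℕ} (B : Matrix (Fin p) (Fin m) ℝ) (σ : ℝ)
    (loss : Equiv.Perm (Fin n) → Equiv.Perm (Fin n) → ℝ≥0∞)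
    (est : PermEstimator n p m) (π : Equiv.Perm (Fin n)) : ℝ≥0∞ :=
  ∫⁻ z, loss (est.toFun (z.1, response B π z.1 z.2)) π
    ∂((gaussianMatrix n p 1).prod (gaussianMatrix n m (σ ^ 2).toNNReal))

/-- The minimax risk for known `B` and `σ`: infimum over all estimators of the supremum over all
permutations of the expected loss. As `B` and `σ` are fixed before the infimum is taken, the
estimators may depend on them. -/
noncomputable def minimaxPermRisk (n : ℕ) {p m : ℕ} (B : Matrix (Fin p) (Fin m) ℝ) (σ : ℝ)
    (loss : Equiv.Perm (Fin n) → Equiv.Perm (Fin n) → ℝ≥0∞) : ℝ≥0∞ :=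
  ⨅ est : PermEstimator n p m, ⨆ π : Equiv.Perm (Fin n), permRisk B σ loss est π

/-- `log det (I + Bᵀ B / σ²)`. -/
noncomputable def logDetSNR {p m : ℕ} (B : Matrix (Fin p) (Fin m) ℝ) (σ : ℝ) : ℝ :=
  Real.log (1 + (σ ^ 2)⁻¹ • (B.transpose * B)).det

/-! The supremum over permutations dominates the average over a uniform one, so it suffices to bound
average risks. Let `A` satisfy `AᵀA = I + BᵀB/σ²`. Then `W * A` has the marginal law of the
response, and the law of `(X, W * A)` is one reference law for every `π`. The divergence from the
law of the data under `π` to this reference is `n log|det A|`, which is `(n/2) logDetSNR`. Under the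
reference the data carry no information on `π`, so the variational formula for the divergence bounds
the average of `f(estimate, π)` by `(n/2) logDetSNR + log K` whenever `∑ π, exp (f τ π) ≤ n! K` for
all `τ` (`sum_integral_le_of_sum_exp_le`).

For (a), `f` is a multiple of the indicator of a Hamming ball, and the ball of radius `k` has at
most `n!/(n-k)!` elements. This is Fano's inequality.

For (b), Fano followed by Markov's inequality would give only `(n-d)!` in the denominator. For `1 ≤
d ≤ n-2` one takes `f = -t * permHamming` with `exp (t (d+1)) = (n-d+1)!`. The exponential moment
bound `sum_inv_pow_permHamming_le` gains the missing factor, using that two permutations never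
differ in exactly one place. For `d = n-1` the bound is nonpositive.

For `d = 0` that moment bound fails, since the term `π = τ` alone is too large. There `π` is
compared with `π * swap i j` by Le Cam's method, conditionally on `X`. Averaging over `X`, over `π`
and over coordinates gives `average_permHamming_ge_of_two_le`, and `exists_fano_le_transposition`
shows numerically that this dominates the required bound. -/

/-! ### Gaussian matrices: densities and changes of variables -/

theorem pi_withDensity_ofReal {ι : Type*} [Fintype ι] {α : ι → Type*}
    [∀ i, MeasurableSpace (α i)] (μ : ∀ i, Measure (α i)) [∀ i, SigmaFinite (μ i)]
    (f : ∀ i, α i → ℝ) (hf0 : ∀ i x, 0 ≤ f i x)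
    (hint : ∀ i, Integrable (f i) (μ i)) :
    Measure.pi (fun i => (μ i).withDensity fun x => ENNReal.ofReal (f i x)) =
      (Measure.pi μ).withDensity fun x => ENNReal.ofReal (∏ i, f i (x i)) := by
  refine (Measure.pi_eq fun s hs => ?_)
  rw [withDensity_apply _ (MeasurableSet.univ_pi hs), Measure.restrict_pi_pi,
    ← ofReal_integral_eq_lintegral_ofReal, integral_fintype_prod_eq_prod, ENNReal.ofReal_prod_of_nonneg]
  · refine Finset.prod_congr rfl fun i _ => ?_
    rw [withDensity_apply _ (hs i), ← ofReal_integral_eq_lintegral_ofReal]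
    · exact (hint i).restrict
    · exact Filter.Eventually.of_forall fun x => hf0 i x
  · exact fun i _ => integral_nonneg fun x => hf0 i x
  · exact Integrable.fintype_prod_dep fun i => (hint i).restrict
  · exact Filter.Eventually.of_forall fun x => Finset.prod_nonneg fun i _ => hf0 i _

/-- The squared Frobenius norm. -/
noncomputable def frobSq {k l : ℕ} (x : Matrix (Fin k) (Fin l) ℝ) : ℝ := ∑ i, ∑ j, x i j ^ 2

/-- The Frobenius inner product. -/
noncomputable def frobInner {k l : ℕ} (x y : Matrix (Fin k) (Fin l) ℝ) : ℝ :=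
  ∑ i, ∑ j, x i j * y i j

theorem frobSq_nonneg {k l : ℕ} (x : Matrix (Fin k) (Fin l) ℝ) : 0 ≤ frobSq x :=
  Finset.sum_nonneg fun _ _ => Finset.sum_nonneg fun _ _ => sq_nonneg _

theorem frobSq_add {k l : ℕ} (x y : Matrix (Fin k) (Fin l) ℝ) :
    frobSq (x + y) = frobSq x + 2 * frobInner x y + frobSq y := by
  simp only [frobSq, frobInner, Matrix.add_apply, Finset.mul_sum, ← Finset.sum_add_distrib]
  exact Finset.sum_congr rfl fun _ _ => Finset.sum_congr rfl fun _ _ => by ring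

theorem gaussianMatrix_eq_pi (k l : ℕ) (v : ℝ≥0) :
    gaussianMatrix k l v =
      (Measure.pi fun _ : Fin k => Measure.pi fun _ : Fin l => gaussianReal 0 v) :=
  Measure.map_id

instance instIsProbabilityMeasureGaussianMatrix (k l : ℕ) (v : ℝ≥0) :
    IsProbabilityMeasure (gaussianMatrix k l v) := by
  rw [gaussianMatrix_eq_pi]; exact Measure.pi.instIsProbabilityMeasure _

theorem measurable_matrix_entry {k l : ℕ} (i : Fin k) (j : Fin l) :
    Measurable fun x : Matrix (Fin k) (Fin l) ℝ => x i j :=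
  (measurable_pi_apply j).comp (measurable_pi_apply i)

theorem measurable_matrix_of_entries {α : Type*} [MeasurableSpace α] {k l : ℕ}
    {f : α → Matrix (Fin k) (Fin l) ℝ} (hf : ∀ i j, Measurable fun a => f a i j) :
    Measurable f :=
  measurable_pi_lambda _ fun i => measurable_pi_lambda _ fun j => hf i j

theorem Measurable.matrix_entry {α : Type*} [MeasurableSpace α] {k l : ℕ}
    {f : α → Matrix (Fin k) (Fin l) ℝ} (hf : Measurable f) (i : Fin k) (j : Fin l) :
    Measurable fun a => f a i j :=
  (measurable_matrix_entry i j).comp hf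

theorem Measurable.matrix_mul {α : Type*} [MeasurableSpace α] {k l r : ℕ}
    {f : α → Matrix (Fin k) (Fin l) ℝ} {g : α → Matrix (Fin l) (Fin r) ℝ}
    (hf : Measurable f) (hg : Measurable g) : Measurable fun a => f a * g a :=
  measurable_matrix_of_entries fun i j => by
    simp only [Matrix.mul_apply]
    exact Finset.measurable_sum _ fun s _ => (hf.matrix_entry i s).mul (hg.matrix_entry s j)

theorem Measurable.matrix_add {α : Type*} [MeasurableSpace α] {k l : ℕ}
    {f g : α → Matrix (Fin k) (Fin l) ℝ}
    (hf : Measurable f) (hg : Measurable g) : Measurable fun a => f a + g a :=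
  measurable_matrix_of_entries fun i j => (hf.matrix_entry i j).add (hg.matrix_entry i j)

theorem Measurable.frobInner {α : Type*} [MeasurableSpace α] {k l : ℕ}
    {f g : α → Matrix (Fin k) (Fin l) ℝ}
    (hf : Measurable f) (hg : Measurable g) : Measurable fun a => frobInner (f a) (g a) :=
  Finset.measurable_sum _ fun i _ => Finset.measurable_sum _ fun j _ =>
    (hf.matrix_entry i j).mul (hg.matrix_entry i j)

theorem Measurable.frobSq {α : Type*} [MeasurableSpace α] {k l : ℕ}
    {f : α → Matrix (Fin k) (Fin l) ℝ}
    (hf : Measurable f) : Measurable fun a => frobSq (f a) :=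
  Finset.measurable_sum _ fun i _ => Finset.measurable_sum _ fun j _ =>
    (hf.matrix_entry i j).pow_const 2

theorem prod_gaussianPDFReal {k l : ℕ} (v : ℝ≥0) (x : Matrix (Fin k) (Fin l) ℝ) :
    ∏ i, ∏ j, gaussianPDFReal 0 v (x i j) =
      ((√(2 * Real.pi * v))⁻¹ ^ l) ^ k * Real.exp (-frobSq x / (2 * v)) := by
  simp only [gaussianPDFReal, Finset.prod_mul_distrib, Finset.prod_const, Finset.card_univ,
    Fintype.card_fin, sub_zero, ← Real.exp_sum]
  congr 2
  simp only [frobSq, neg_div, Finset.sum_div, Finset.sum_neg_distrib]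

theorem gaussianMatrix_eq_withDensity (k l : ℕ) {v : ℝ≥0} (hv : v ≠ 0) :
    gaussianMatrix k l v =
      (volume : Measure (Fin k → Fin l → ℝ)).withDensity fun x => ENNReal.ofReal
        (((√(2 * Real.pi * v))⁻¹ ^ l) ^ k * Real.exp (-frobSq x / (2 * v))) := by
  have h1 : (Measure.pi fun _ : Fin l => gaussianReal 0 v) =
      (volume : Measure (Fin l → ℝ)).withDensity
        fun x => ENNReal.ofReal (∏ j, gaussianPDFReal 0 v (x j)) := by
    rw [gaussianReal_of_var_ne_zero _ hv]
    exact pi_withDensity_ofReal _ _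
      (fun _ => gaussianPDFReal_nonneg 0 v) fun _ => integrable_gaussianPDFReal 0 v
  rw [gaussianMatrix_eq_pi, h1]
  have h2 := pi_withDensity_ofReal (fun _ : Fin k => (volume : Measure (Fin l → ℝ)))
    (fun _ x => ∏ j, gaussianPDFReal 0 v (x j))
    (fun _ x => Finset.prod_nonneg fun j _ => gaussianPDFReal_nonneg 0 v _)
    (fun _ => Integrable.fintype_prod_dep fun _ => integrable_gaussianPDFReal 0 v)
  rw [h2]
  exact congrArg _ (funext fun x => congrArg _ (prod_gaussianPDFReal v x))

/-- Right multiplication of a matrix by `A`, as a linear map on the space of families of rows. -/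
noncomputable def rowMulRight (k : ℕ) {l : ℕ} (A : Matrix (Fin l) (Fin l) ℝ) :
    (Fin k → Fin l → ℝ) →ₗ[ℝ] (Fin k → Fin l → ℝ) :=
  LinearMap.pi fun i => A.vecMulLinear.comp (LinearMap.proj i)

theorem det_rowMulRight (k : ℕ) {l : ℕ} (A : Matrix (Fin l) (Fin l) ℝ) :
    LinearMap.det (rowMulRight k A) = A.det ^ k := by
  have h : LinearMap.det A.vecMulLinear = A.det := by
    rw [← Matrix.det_transpose, ← LinearMap.det_toLin']
    congr 1
    ext x : 2
    simp
  rw [rowMulRight, LinearMap.det_pi, h]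
  simp

/-- The density of `gaussianMatrix`. -/
noncomputable def gaussianMatrixDensity {k l : ℕ} (v : ℝ≥0) (x : Matrix (Fin k) (Fin l) ℝ) : ℝ :=
  ((√(2 * Real.pi * v))⁻¹ ^ l) ^ k * Real.exp (-frobSq x / (2 * v))

theorem measurable_gaussianMatrixDensity (k l : ℕ) (v : ℝ≥0) :
    Measurable (gaussianMatrixDensity v : Matrix (Fin k) (Fin l) ℝ → ℝ) :=
  ((((Measurable.frobSq measurable_id).neg.div_const _).exp).const_mul _)

theorem lintegral_gaussianMatrix (k l : ℕ) {v : ℝ≥0} (hv : v ≠ 0)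
    {g : Matrix (Fin k) (Fin l) ℝ → ℝ≥0∞} (hg : Measurable g) :
    ∫⁻ z, g z ∂gaussianMatrix k l v =
      ∫⁻ x : Fin k → Fin l → ℝ,
        ENNReal.ofReal (gaussianMatrixDensity v (Matrix.of x)) * g (Matrix.of x) := by
  rw [gaussianMatrix_eq_withDensity k l hv]
  exact lintegral_withDensity_eq_lintegral_mul _
    (measurable_gaussianMatrixDensity k l v).ennreal_ofReal hg

/-- Change of variables `z ↦ z A - μ` under the Gaussian law. -/
theorem lintegral_gaussianMatrix_mul (k : ℕ) {l : ℕ} {v : ℝ≥0} (hv : v ≠ 0)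
    {A : Matrix (Fin l) (Fin l) ℝ} (hA : A.det ≠ 0) (μ : Matrix (Fin k) (Fin l) ℝ)
    {g : Matrix (Fin k) (Fin l) ℝ → ℝ≥0∞} (hg : Measurable g) :
    ∫⁻ z, g (z * A) ∂gaussianMatrix k l v =
      ∫⁻ w, g (w + μ) * ENNReal.ofReal (|A.det ^ k|⁻¹ *
        Real.exp ((frobSq w - frobSq ((w + μ) * A⁻¹)) / (2 * v))) ∂gaussianMatrix k l v := by
  have hdm := (measurable_gaussianMatrixDensity k l v).ennreal_ofReal
  have hAu : IsUnit A.det := isUnit_iff_ne_zero.2 hA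
  have hAm : Measurable fun z : Matrix (Fin k) (Fin l) ℝ => z * A :=
    measurable_id.matrix_mul measurable_const
  have hAm' : Measurable fun z : Matrix (Fin k) (Fin l) ℝ => z * A⁻¹ :=
    measurable_id.matrix_mul measurable_const
  have hshift : Measurable fun z : Matrix (Fin k) (Fin l) ℝ => z + μ :=
    measurable_id.matrix_add measurable_const
  rw [lintegral_gaussianMatrix k l hv (g := fun z => g (z * A)) (hg.comp hAm),
    lintegral_gaussianMatrix k l hv]
  swap
  · refine (hg.comp hshift).mul ?_
    refine Measurable.ennreal_ofReal (Measurable.const_mul ?_ _)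
    exact (((Measurable.frobSq measurable_id).sub
      (Measurable.frobSq (hAm'.comp hshift))).div_const _).exp
  have hdet : LinearMap.det (rowMulRight k A) ≠ 0 := by
    rw [det_rowMulRight]; exact pow_ne_zero _ hA
  set h : (Fin k → Fin l → ℝ) → ℝ≥0∞ := fun y =>
    ENNReal.ofReal (gaussianMatrixDensity v (Matrix.of y * A⁻¹)) * g (Matrix.of y) with hh
  have hhm : Measurable h := (hdm.comp hAm').mul hg
  let μ' : Fin k → Fin l → ℝ := μ
  have e1 : ∫⁻ z, h (rowMulRight k A z) =
      ENNReal.ofReal |(A.det ^ k)⁻¹| * ∫⁻ y, h y := by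
    rw [← lintegral_map hhm (LinearMap.continuous_of_finiteDimensional _).measurable,
      Measure.map_linearMap_addHaar_eq_smul_addHaar volume hdet, lintegral_smul_measure,
      det_rowMulRight, smul_eq_mul]
  calc _ = ∫⁻ z, h (rowMulRight k A z) := by
        refine lintegral_congr fun z => ?_
        have e : Matrix.of (rowMulRight k A z) = Matrix.of z * A := rfl
        simp only [hh, e]
        rw [Matrix.mul_assoc, Matrix.mul_nonsing_inv _ hAu, Matrix.mul_one]
    _ = ENNReal.ofReal |(A.det ^ k)⁻¹| * ∫⁻ w, h (w + μ') := by
        rw [e1, lintegral_add_right_eq_self (μ := (volume : Measure (Fin k → Fin l → ℝ))) h μ']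
    _ = ∫⁻ w, ENNReal.ofReal |(A.det ^ k)⁻¹| * h (w + μ') := by
        exact (lintegral_const_mul _ (hhm.comp (measurable_id.add_const μ'))).symm
    _ = _ := by
        refine lintegral_congr fun w => ?_
        have e : Matrix.of (w + μ') = Matrix.of w + μ := rfl
        simp only [hh, e]
        generalize Matrix.of w = w'
        rw [mul_left_comm (ENNReal.ofReal (gaussianMatrixDensity v w')), ← mul_assoc,
          mul_comm _ (g _)]
        refine congrArg₂ _ rfl ?_
        have h0 : 0 ≤ gaussianMatrixDensity v w' := by unfold gaussianMatrixDensity; positivity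
        rw [← ENNReal.ofReal_mul (abs_nonneg _), ← ENNReal.ofReal_mul h0]
        congr 1
        simp only [gaussianMatrixDensity, abs_inv]
        have hexp : Real.exp (-frobSq ((w' + μ) * A⁻¹) / (2 * v)) =
            Real.exp (-frobSq w' / (2 * v)) *
              Real.exp ((frobSq w' - frobSq ((w' + μ) * A⁻¹)) / (2 * v)) := by
          rw [← Real.exp_add]; congr 1; ring
        rw [hexp]
        ring

/-- The Cameron–Martin formula for Gaussian matrices. -/
theorem lintegral_gaussianMatrix_add {k l : ℕ} {v : ℝ≥0} (hv : v ≠ 0)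
    (μ : Matrix (Fin k) (Fin l) ℝ) {g : Matrix (Fin k) (Fin l) ℝ → ℝ≥0∞} (hg : Measurable g) :
    ∫⁻ w, g (w + μ) ∂gaussianMatrix k l v =
      ∫⁻ z, g z * ENNReal.ofReal (Real.exp (frobInner z μ / v - frobSq μ / (2 * v)))
        ∂gaussianMatrix k l v := by
  have hv' : (v : ℝ) ≠ 0 := by exact_mod_cast hv
  have hm : Measurable fun z : Matrix (Fin k) (Fin l) ℝ =>
      ENNReal.ofReal (Real.exp (frobInner z μ / v - frobSq μ / (2 * v))) :=
    ((((Measurable.frobInner measurable_id measurable_const).div_const _).sub_const _).exp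
      ).ennreal_ofReal
  have h := lintegral_gaussianMatrix_mul k hv (A := 1) (by simp) μ (hg.mul hm)
  simp only [Pi.mul_apply, Matrix.mul_one] at h
  rw [h]
  refine lintegral_congr fun w => ?_
  rw [mul_assoc, ← ENNReal.ofReal_mul (Real.exp_nonneg _)]
  have e : Real.exp (frobInner (w + μ) μ / v - frobSq μ / (2 * v)) *
      (|Matrix.det (1 : Matrix (Fin l) (Fin l) ℝ) ^ k|⁻¹ *
        Real.exp ((frobSq w - frobSq ((w + μ) * (1 : Matrix (Fin l) (Fin l) ℝ)⁻¹)) / (2 * v))) = 1 := by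
    have e1 : frobInner (w + μ) μ = frobInner w μ + frobSq μ := by
      simp only [frobSq, frobInner, Matrix.add_apply, ← Finset.sum_add_distrib]
      exact Finset.sum_congr rfl fun _ _ => Finset.sum_congr rfl fun _ _ => by ring
    rw [inv_one, Matrix.mul_one, frobSq_add, e1, Matrix.det_one, one_pow, abs_one, inv_one, one_mul,
      ← Real.exp_add, Real.exp_eq_one_iff]
    field_simp
    ring
  rw [e]; simp

/-! ### Gaussian matrices: linear forms and second moments -/

theorem frobSq_smul {k l : ℕ} (t : ℝ) (x : Matrix (Fin k) (Fin l) ℝ) :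
    frobSq (t • x) = t ^ 2 * frobSq x := by
  simp only [frobSq, Matrix.smul_apply, smul_eq_mul, mul_pow, Finset.mul_sum]

theorem frobInner_smul_left {k l : ℕ} (t : ℝ) (x y : Matrix (Fin k) (Fin l) ℝ) :
    frobInner (t • x) y = t * frobInner x y := by
  simp only [frobInner, Matrix.smul_apply, smul_eq_mul, mul_assoc, Finset.mul_sum]

theorem integral_cexp_frobInner (k l : ℕ) (v : ℝ≥0) (c : Matrix (Fin k) (Fin l) ℝ) :
    ∫ x, Complex.exp (frobInner c x * Complex.I) ∂gaussianMatrix k l v =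
      Complex.exp (-(v * frobSq c / 2 : ℝ)) := by
  have h1 : ∀ i j, ∫ y : ℝ, Complex.exp ((c i j * y : ℝ) * Complex.I) ∂gaussianReal 0 v =
      Complex.exp (-(v * c i j ^ 2 / 2 : ℝ)) := fun i j => by
    have := charFun_gaussianReal (μ := 0) (v := v) (c i j)
    rw [charFun_apply_real] at this
    simpa using this
  calc _ = ∫ x : Fin k → Fin l → ℝ, ∏ i, ∏ j, Complex.exp ((c i j * x i j : ℝ) * Complex.I)
          ∂(Measure.pi fun _ => Measure.pi fun _ => gaussianReal 0 v) := by
        rw [gaussianMatrix_eq_pi]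
        refine integral_congr_ae (Filter.Eventually.of_forall fun x => ?_)
        simp only [← Complex.exp_sum, frobInner, Complex.ofReal_sum, Finset.sum_mul]
    _ = ∏ i, ∏ j, Complex.exp (-(v * c i j ^ 2 / 2 : ℝ)) := by
        rw [integral_fintype_prod_eq_prod (f := fun i (y : Fin l → ℝ) =>
          ∏ j, Complex.exp ((c i j * y j : ℝ) * Complex.I))]
        refine Finset.prod_congr rfl fun i _ => ?_
        rw [integral_fintype_prod_eq_prod (f := fun j (y : ℝ) =>
          Complex.exp ((c i j * y : ℝ) * Complex.I))]
        exact Finset.prod_congr rfl fun j _ => h1 i j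
    _ = _ := by
        simp only [← Complex.exp_sum, frobSq, Finset.mul_sum, Finset.sum_div, Complex.ofReal_sum,
          Finset.sum_neg_distrib]

theorem measurable_frobInner_left {k l : ℕ} (c : Matrix (Fin k) (Fin l) ℝ) :
    Measurable fun x => frobInner c x :=
  Measurable.frobInner measurable_const measurable_id

/-- A linear form of a Gaussian matrix is Gaussian. -/
theorem map_frobInner_gaussianMatrix (k l : ℕ) (v : ℝ≥0) (c : Matrix (Fin k) (Fin l) ℝ) :
    (gaussianMatrix k l v).map (fun x => frobInner c x) =
      gaussianReal 0 (v * (frobSq c).toNNReal) := by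
  have := Measure.isProbabilityMeasure_map (μ := gaussianMatrix k l v)
    (measurable_frobInner_left c).aemeasurable
  refine Measure.ext_of_charFun (funext fun t => ?_)
  rw [charFun_apply_real, charFun_gaussianReal,
    integral_map (measurable_frobInner_left c).aemeasurable (by fun_prop)]
  have h := integral_cexp_frobInner k l v (t • c)
  simp only [frobInner_smul_left, frobSq_smul, Complex.ofReal_mul] at h
  rw [h]
  congr 1
  simp [Real.coe_toNNReal _ (frobSq_nonneg c)]
  ring

theorem integral_frobInner_sq (k l : ℕ) (v : ℝ≥0) (c : Matrix (Fin k) (Fin l) ℝ) :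
    Integrable (fun x => frobInner c x ^ 2) (gaussianMatrix k l v) ∧
    ∫ x, frobInner c x ^ 2 ∂gaussianMatrix k l v = v * frobSq c := by
  have hm := (measurable_frobInner_left c).aemeasurable (μ := gaussianMatrix k l v)
  have hL : MemLp (fun y : ℝ => y) 2 (gaussianReal 0 (v * (frobSq c).toNNReal)) :=
    memLp_id_gaussianReal 2
  constructor
  · have := hL.integrable_sq
    rw [← map_frobInner_gaussianMatrix] at this
    exact this.comp_aemeasurable hm
  · have h := variance_fun_id_gaussianReal (μ := 0) (v := v * (frobSq c).toNNReal)
    rw [variance_eq_integral (by fun_prop), integral_id_gaussianReal] at h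
    simp only [sub_zero] at h
    rw [← map_frobInner_gaussianMatrix, integral_map hm (by fun_prop)] at h
    rw [h]
    simp [Real.coe_toNNReal _ (frobSq_nonneg c)]

theorem integral_frobInner (k l : ℕ) (v : ℝ≥0) (c : Matrix (Fin k) (Fin l) ℝ) :
    Integrable (fun x => frobInner c x) (gaussianMatrix k l v) ∧
    ∫ x, frobInner c x ∂gaussianMatrix k l v = 0 := by
  have hm := (measurable_frobInner_left c).aemeasurable (μ := gaussianMatrix k l v)
  have hL : MemLp (fun y : ℝ => y) 1 (gaussianReal 0 (v * (frobSq c).toNNReal)) :=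
    memLp_id_gaussianReal 1
  constructor
  · have := hL.integrable le_rfl
    rw [← map_frobInner_gaussianMatrix] at this
    exact this.comp_aemeasurable hm
  · have h := integral_id_gaussianReal (μ := 0) (v := v * (frobSq c).toNNReal)
    rwa [← map_frobInner_gaussianMatrix, integral_map hm (by fun_prop)] at h

/-- The mean of the squared Frobenius norm of `X C`. -/
theorem integral_frobSq_mul (k l r : ℕ) (v : ℝ≥0) (C : Matrix (Fin l) (Fin r) ℝ) :
    Integrable (fun x => frobSq (x * C)) (gaussianMatrix k l v) ∧
    ∫ x, frobSq (x * C) ∂gaussianMatrix k l v = k * (v * frobSq C) := by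
  classical
  set c : Fin k → Fin r → Matrix (Fin k) (Fin l) ℝ := fun i j =>
    Matrix.of fun a b => if a = i then C b j else 0 with hc
  have h1 : ∀ i j (x : Matrix (Fin k) (Fin l) ℝ), (x * C) i j = frobInner (c i j) x := by
    intro i j x
    simp only [frobInner, hc, Matrix.of_apply, ite_mul, zero_mul, Matrix.mul_apply]
    rw [Finset.sum_eq_single i]
    · simp [mul_comm]
    · intro b _ hb; simp [hb]
    · simp
  have h2 : ∀ i j, frobSq (c i j) = ∑ b, C b j ^ 2 := by
    intro i j
    simp only [frobSq, hc, Matrix.of_apply]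
    rw [Finset.sum_eq_single i]
    · simp
    · intro b _ hb; simp [hb]
    · simp
  have e : (fun x : Matrix (Fin k) (Fin l) ℝ => frobSq (x * C)) =
      fun x => ∑ i, ∑ j, frobInner (c i j) x ^ 2 := by
    funext x; simp only [frobSq, h1]
  rw [e]
  constructor
  · exact integrable_finsetSum _ fun i _ => integrable_finsetSum _ fun j _ =>
      (integral_frobInner_sq k l v _).1
  · rw [integral_finsetSum _ fun i _ => integrable_finsetSum _ fun j _ =>
      (integral_frobInner_sq k l v _).1]
    have : ∀ i, ∫ x, ∑ j, frobInner (c i j) x ^ 2 ∂gaussianMatrix k l v = v * frobSq C := by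
      intro i
      rw [integral_finsetSum _ fun j _ => (integral_frobInner_sq k l v _).1]
      simp only [(integral_frobInner_sq k l v _).2, h2, ← Finset.mul_sum]
      rw [frobSq, Finset.sum_comm]
    simp [this]

/-! ### The reference law and the divergence from it -/

theorem frobSq_permMatrix_mul {n l : ℕ} (π : Equiv.Perm (Fin n)) (x : Matrix (Fin n) (Fin l) ℝ) :
    frobSq (π.permMatrix ℝ * x) = frobSq x := by
  rw [Equiv.Perm.permMatrix, PEquiv.toMatrix_toPEquiv_mul]
  exact Equiv.sum_comp π fun i => ∑ j, x i j ^ 2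

theorem frobSq_eq_trace {k l : ℕ} (x : Matrix (Fin k) (Fin l) ℝ) :
    frobSq x = (x.transpose * x).trace := by
  simp only [frobSq, Matrix.trace, Matrix.diag, Matrix.mul_apply, Matrix.transpose_apply]
  rw [Finset.sum_comm]
  exact Finset.sum_congr rfl fun _ _ => Finset.sum_congr rfl fun _ _ => by ring

/-- Rows of the response have covariance `BᵀB + v I = v AᵀA`, so noise multiplied by `A` on the
right has the law of the response. -/
theorem exists_transpose_mul_self_eq {p m : ℕ} (B : Matrix (Fin p) (Fin m) ℝ) {v : ℝ}
    (hv : 0 < v) : ∃ A : Matrix (Fin m) (Fin m) ℝ, A.det ≠ 0 ∧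
      A.transpose * A = 1 + v⁻¹ • (B.transpose * B) := by
  have h : (1 + v⁻¹ • (B.transpose * B)).PosDef := by
    refine Matrix.PosDef.one.add_posSemidef (Matrix.PosSemidef.smul ?_ (inv_nonneg.2 hv.le))
    simpa using Matrix.posSemidef_conjTranspose_mul_self B
  open scoped MatrixOrder Matrix.Norms.L2Operator in
  obtain ⟨A, hA⟩ := CStarAlgebra.nonneg_iff_eq_star_mul_self.mp h.posSemidef.nonneg
  have hA' : A.transpose * A = 1 + v⁻¹ • (B.transpose * B) := by
    rw [hA, Matrix.star_eq_conjTranspose, Matrix.conjTranspose_eq_transpose_of_trivial]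
  refine ⟨A, fun h0 => h.det_pos.ne' ?_, hA'⟩
  rw [← hA', Matrix.det_mul, h0, mul_zero]

theorem logDetSNR_eq {p m : ℕ} {B : Matrix (Fin p) (Fin m) ℝ} {σ : ℝ}
    {A : Matrix (Fin m) (Fin m) ℝ}
    (hA : A.transpose * A = 1 + (σ ^ 2)⁻¹ • (B.transpose * B)) :
    logDetSNR B σ = 2 * Real.log |A.det| := by
  rw [logDetSNR, ← hA, Matrix.det_mul, Matrix.det_transpose, ← abs_mul_abs_self, ← sq,
    Real.log_pow]
  simp

/-- Trace of `A⁻ᵀ (v I + BᵀB) A⁻¹ = v I`. It says that the whitened response `Y A⁻¹` has the same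
mean squared norm as the noise, so the quadratic terms of the log-likelihood ratio cancel in mean.
-/
theorem frobSq_inv_add {p m : ℕ} {B : Matrix (Fin p) (Fin m) ℝ} {v : ℝ} (hv : 0 < v)
    {A : Matrix (Fin m) (Fin m) ℝ} (hA0 : A.det ≠ 0)
    (hA : A.transpose * A = 1 + v⁻¹ • (B.transpose * B)) :
    v * frobSq A⁻¹ + frobSq (B * A⁻¹) = v * m := by
  have hu : IsUnit A.det := isUnit_iff_ne_zero.2 hA0
  have h1 : v • (1 : Matrix (Fin m) (Fin m) ℝ) + B.transpose * B = v • (A.transpose * A) := by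
    rw [hA, smul_add, smul_smul, mul_inv_cancel₀ hv.ne', one_smul]
  have h2 : A⁻¹.transpose * (v • (1 : Matrix (Fin m) (Fin m) ℝ) + B.transpose * B) * A⁻¹ =
      v • 1 := by
    rw [h1, Matrix.mul_smul, Matrix.smul_mul, ← Matrix.mul_assoc, Matrix.mul_assoc,
      Matrix.mul_nonsing_inv _ hu, Matrix.mul_one, ← Matrix.transpose_mul,
      Matrix.mul_nonsing_inv _ hu, Matrix.transpose_one]
  have h3 := congrArg Matrix.trace h2
  rw [Matrix.trace_smul, Matrix.trace_one, Fintype.card_fin, smul_eq_mul] at h3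
  rw [← h3, frobSq_eq_trace, frobSq_eq_trace, Matrix.transpose_mul, Matrix.mul_add, Matrix.add_mul,
    Matrix.trace_add, Matrix.mul_smul, Matrix.smul_mul, Matrix.trace_smul, smul_eq_mul,
    Matrix.mul_one]
  simp only [Matrix.mul_assoc]

/-- The joint law of the design and the noise. -/
noncomputable abbrev dataLaw (n p m : ℕ) (v : ℝ≥0) :
    Measure (Matrix (Fin n) (Fin p) ℝ × Matrix (Fin n) (Fin m) ℝ) :=
  (gaussianMatrix n p 1).prod (gaussianMatrix n m v)

/-- The integrand is bilinear in the independent centred matrices `X` and `W`. -/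
theorem integral_frobInner_mul_mul {n p m r : ℕ} (v : ℝ≥0) (P : Matrix (Fin n) (Fin n) ℝ)
    (C : Matrix (Fin m) (Fin r) ℝ) (D : Matrix (Fin p) (Fin r) ℝ) :
    Integrable (fun z => frobInner (z.2 * C) (P * z.1 * D)) (dataLaw n p m v) ∧
    ∫ z, frobInner (z.2 * C) (P * z.1 * D) ∂dataLaw n p m v = 0 := by
  classical
  set c : Fin n → Fin r → Matrix (Fin n) (Fin m) ℝ := fun i j =>
    Matrix.of fun a b => if a = i then C b j else 0 with hc
  set d : Fin n → Fin r → Matrix (Fin n) (Fin p) ℝ := fun i j =>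
    Matrix.of fun a b => P i a * D b j with hd
  have h1 : ∀ i j (x : Matrix (Fin n) (Fin m) ℝ), (x * C) i j = frobInner (c i j) x := by
    intro i j x
    simp only [frobInner, hc, Matrix.of_apply, ite_mul, zero_mul, Matrix.mul_apply]
    rw [Finset.sum_eq_single i]
    · simp [mul_comm]
    · intro b _ hb; simp [hb]
    · simp
  have h2 : ∀ i j (x : Matrix (Fin n) (Fin p) ℝ), (P * x * D) i j = frobInner (d i j) x := by
    intro i j x
    simp only [frobInner, hd, Matrix.of_apply, Matrix.mul_apply, Finset.sum_mul]
    rw [Finset.sum_comm]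
    exact Finset.sum_congr rfl fun _ _ => Finset.sum_congr rfl fun _ _ => by ring
  have e : (fun z : Matrix (Fin n) (Fin p) ℝ × Matrix (Fin n) (Fin m) ℝ =>
      frobInner (z.2 * C) (P * z.1 * D)) =
      fun z => ∑ i, ∑ j, frobInner (d i j) z.1 * frobInner (c i j) z.2 := by
    funext z
    simp only [← h1, ← h2]
    simp only [frobInner, mul_comm]
  have hint : ∀ i j, Integrable (fun z : Matrix (Fin n) (Fin p) ℝ × Matrix (Fin n) (Fin m) ℝ =>
      frobInner (d i j) z.1 * frobInner (c i j) z.2) (dataLaw n p m v) := fun i j =>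
    (integral_frobInner n p 1 (d i j)).1.mul_prod (integral_frobInner n m v (c i j)).1
  rw [e]
  refine ⟨integrable_finsetSum _ fun i _ => integrable_finsetSum _ fun j _ => hint i j, ?_⟩
  rw [integral_finsetSum _ fun i _ => integrable_finsetSum _ fun j _ => hint i j]
  refine Finset.sum_eq_zero fun i _ => ?_
  rw [integral_finsetSum _ fun j _ => hint i j]
  refine Finset.sum_eq_zero fun j _ => ?_
  rw [integral_prod_mul, (integral_frobInner n p 1 (d i j)).2, zero_mul]

theorem integral_affine_combination {α : Type*} [MeasurableSpace α] {μ : Measure α}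
    [IsProbabilityMeasure μ] {f₁ f₂ f₃ f₄ : α → ℝ} (a c : ℝ) (h₁ : Integrable f₁ μ)
    (h₂ : Integrable f₂ μ) (h₃ : Integrable f₃ μ) (h₄ : Integrable f₄ μ) :
    Integrable (fun z => a + ((f₁ z + 2 * f₂ z + f₃ z) - f₄ z) / c) μ ∧
    ∫ z, a + ((f₁ z + 2 * f₂ z + f₃ z) - f₄ z) / c ∂μ =
      a + ((∫ z, f₁ z ∂μ + 2 * ∫ z, f₂ z ∂μ + ∫ z, f₃ z ∂μ) - ∫ z, f₄ z ∂μ) / c := by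
  have s₁ : Integrable (fun z => f₁ z + 2 * f₂ z) μ := h₁.add (h₂.const_mul 2)
  have s₂ : Integrable (fun z => f₁ z + 2 * f₂ z + f₃ z) μ := s₁.add h₃
  have s₃ : Integrable (fun z => f₁ z + 2 * f₂ z + f₃ z - f₄ z) μ := s₂.sub h₄
  refine ⟨(integrable_const a).add (s₃.div_const c), ?_⟩
  rw [integral_add (integrable_const a) (s₃.div_const c), integral_div, integral_sub s₂ h₄,
    integral_add s₁ h₃, integral_add h₁ (h₂.const_mul 2), integral_const_mul]
  simp

/-- The logarithm of the density of the data for the permutation `π` with respect to the law under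
which `Y` is independent of `X` and has the same marginals. -/
noncomputable def logLikelihoodRatio {n p m : ℕ} (B : Matrix (Fin p) (Fin m) ℝ)
    (A : Matrix (Fin m) (Fin m) ℝ) (v : ℝ) (π : Equiv.Perm (Fin n))
    (z : Matrix (Fin n) (Fin p) ℝ × Matrix (Fin n) (Fin m) ℝ) : ℝ :=
  n * Real.log |A.det| + (frobSq (response B π z.1 z.2 * A⁻¹) - frobSq z.2) / (2 * v)

/-- The relative entropy of the data law with respect to the reference law; it does not depend on
`π`. -/
theorem integral_logLikelihoodRatio {n p m : ℕ} {B : Matrix (Fin p) (Fin m) ℝ} {v : ℝ≥0}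
    (hv : 0 < v) {A : Matrix (Fin m) (Fin m) ℝ} (hA0 : A.det ≠ 0)
    (hA : A.transpose * A = 1 + (v : ℝ)⁻¹ • (B.transpose * B)) (π : Equiv.Perm (Fin n)) :
    Integrable (logLikelihoodRatio B A v π) (dataLaw n p m v) ∧
    ∫ z, logLikelihoodRatio B A v π z ∂dataLaw n p m v = n * Real.log |A.det| := by
  have hvr : (0 : ℝ) < v := by exact_mod_cast hv
  have e : logLikelihoodRatio B A v π = fun z : Matrix (Fin n) (Fin p) ℝ × Matrix (Fin n) (Fin m) ℝ =>
      n * Real.log |A.det| + ((frobSq (z.2 * A⁻¹) + 2 * frobInner (z.2 * A⁻¹)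
        (π.permMatrix ℝ * z.1 * (B * A⁻¹)) + frobSq (z.1 * (B * A⁻¹))) -
        frobSq (z.2 * (1 : Matrix (Fin m) (Fin m) ℝ))) / (2 * v) := by
    funext z
    rw [logLikelihoodRatio, response, add_comm (_ * B), Matrix.add_mul, frobSq_add, Matrix.mul_one]
    have : π.permMatrix ℝ * z.1 * B * A⁻¹ = π.permMatrix ℝ * (z.1 * (B * A⁻¹)) := by
      simp only [Matrix.mul_assoc]
    rw [this, frobSq_permMatrix_mul, ← Matrix.mul_assoc (π.permMatrix ℝ)]
  have i1 := integral_frobSq_mul n m m v A⁻¹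
  have i2 := integral_frobSq_mul n p m 1 (B * A⁻¹)
  have i3 := integral_frobSq_mul n m m v 1
  have i4 := integral_frobInner_mul_mul v (π.permMatrix ℝ) A⁻¹ (B * A⁻¹)
  have j1 := i1.1.comp_snd (μ := gaussianMatrix n p 1)
  have j2 := i2.1.comp_fst (ν := gaussianMatrix n m v)
  have j3 := i3.1.comp_snd (μ := gaussianMatrix n p 1)
  have k1 : ∫ z, frobSq (z.2 * A⁻¹) ∂dataLaw n p m v = n * (v * frobSq A⁻¹) := by
    rw [← i1.2, integral_fun_snd (fun y => frobSq (y * A⁻¹))]; simp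
  have k2 : ∫ z, frobSq (z.1 * (B * A⁻¹)) ∂dataLaw n p m v = n * (frobSq (B * A⁻¹)) := by
    rw [integral_fun_fst (fun y => frobSq (y * (B * A⁻¹))), i2.2]; simp
  have k3 : ∫ z, frobSq (z.2 * (1 : Matrix (Fin m) (Fin m) ℝ)) ∂dataLaw n p m v = n * (v * m) := by
    rw [integral_fun_snd (fun y => frobSq (y * (1 : Matrix (Fin m) (Fin m) ℝ))), i3.2]; simp [frobSq_eq_trace]
  rw [e]
  have h := integral_affine_combination (n * Real.log |A.det|) (2 * v) j1 i4.1 j2 j3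
  refine ⟨h.1, h.2.trans ?_⟩
  rw [k1, k2, k3, i4.2, mul_zero, add_zero, ← mul_add, frobSq_inv_add hvr hA0 hA]
  simp

/-! ### Change of measure and the variational bound -/

theorem PermEstimator.measurable_comp {n p m : ℕ} (est : PermEstimator n p m) {β : Type*}
    [MeasurableSpace β] (g : Equiv.Perm (Fin n) → β) : Measurable fun z => g (est.toFun z) := by
  let _ : MeasurableSpace (Equiv.Perm (Fin n)) := ⊤
  have h : Measurable est.toFun := measurable_to_countable' est.measurableSet_fiber
  exact (measurable_from_top (f := g)).comp h

theorem measurable_response {n p m : ℕ} (B : Matrix (Fin p) (Fin m) ℝ) (π : Equiv.Perm (Fin n)) :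
    Measurable fun z : Matrix (Fin n) (Fin p) ℝ × Matrix (Fin n) (Fin m) ℝ =>
      response B π z.1 z.2 :=
  ((measurable_const.matrix_mul measurable_fst).matrix_mul measurable_const).matrix_add
    measurable_snd

theorem measurable_logLikelihoodRatio {n p m : ℕ} (B : Matrix (Fin p) (Fin m) ℝ)
    (A : Matrix (Fin m) (Fin m) ℝ) (v : ℝ) (π : Equiv.Perm (Fin n)) :
    Measurable (logLikelihoodRatio B A v π) :=
  (((Measurable.frobSq ((measurable_response B π).matrix_mul measurable_const)).sub
    (Measurable.frobSq measurable_snd)).div_const _).const_add _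

/-- Change of measure to the law under which the response is independent of the design. -/
theorem lintegral_mul_exp_neg_logLikelihoodRatio {n p m : ℕ} (B : Matrix (Fin p) (Fin m) ℝ)
    {v : ℝ≥0} (hv : 0 < v) {A : Matrix (Fin m) (Fin m) ℝ} (hA0 : A.det ≠ 0)
    (π : Equiv.Perm (Fin n))
    {G : Matrix (Fin n) (Fin p) ℝ × Matrix (Fin n) (Fin m) ℝ → ℝ≥0∞} (hG : Measurable G) :
    ∫⁻ z, G (z.1, response B π z.1 z.2) *
      ENNReal.ofReal (Real.exp (-logLikelihoodRatio B A v π z)) ∂dataLaw n p m v =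
    ∫⁻ z, G (z.1, z.2 * A) ∂dataLaw n p m v := by
  have hm1 : Measurable fun z : Matrix (Fin n) (Fin p) ℝ × Matrix (Fin n) (Fin m) ℝ =>
      G (z.1, response B π z.1 z.2) :=
    hG.comp (measurable_fst.prodMk (measurable_response B π))
  have hm2 : Measurable fun z : Matrix (Fin n) (Fin p) ℝ × Matrix (Fin n) (Fin m) ℝ =>
      G (z.1, z.2 * A) :=
    hG.comp (measurable_fst.prodMk (measurable_snd.matrix_mul measurable_const))
  have hm3 : Measurable fun z => G (z.1, response B π z.1 z.2) *
      ENNReal.ofReal (Real.exp (-logLikelihoodRatio B A v π z)) :=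
    hm1.mul (measurable_logLikelihoodRatio B A v π).neg.exp.ennreal_ofReal
  rw [lintegral_prod _ hm3.aemeasurable, lintegral_prod _ hm2.aemeasurable]
  refine lintegral_congr fun x => ?_
  rw [lintegral_gaussianMatrix_mul n hv.ne' hA0 (π.permMatrix ℝ * x * B)
    (g := fun y => G (x, y)) (hG.comp measurable_prodMk_left)]
  refine lintegral_congr fun w => ?_
  have e : Real.exp (-logLikelihoodRatio B A v π (x, w)) = |A.det ^ n|⁻¹ *
      Real.exp ((frobSq w - frobSq ((w + π.permMatrix ℝ * x * B) * A⁻¹)) / (2 * v)) := by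
    have hpos : 0 < |A.det ^ n| := abs_pos.2 (pow_ne_zero _ hA0)
    rw [← Real.exp_log (inv_pos.2 hpos), ← Real.exp_add, Real.log_inv, abs_pow, Real.log_pow,
      logLikelihoodRatio, response, add_comm w]
    congr 1
    ring
  simp only [e]
  rw [response, add_comm w]

/-- A Donsker–Varadhan bound, averaged over all permutations. -/
theorem sum_integral_le_of_sum_exp_le {n p m : ℕ} (B : Matrix (Fin p) (Fin m) ℝ)
    {v : ℝ≥0} (hv : 0 < v) {A : Matrix (Fin m) (Fin m) ℝ} (hA0 : A.det ≠ 0)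
    (hA : A.transpose * A = 1 + (v : ℝ)⁻¹ • (B.transpose * B)) (est : PermEstimator n p m)
    (f : Equiv.Perm (Fin n) → Equiv.Perm (Fin n) → ℝ) {K : ℝ} (hK : 0 < K)
    (hf : ∀ τ, ∑ π, Real.exp (f τ π) ≤ (n ! : ℝ) * K) :
    ∑ π, ∫ z, f (est.toFun (z.1, response B π z.1 z.2)) π ∂dataLaw n p m v ≤
      (n ! : ℝ) * (n * Real.log |A.det| + Real.log K) := by
  have hcard : (Finset.univ : Finset (Equiv.Perm (Fin n))).card = n ! := by
    rw [Finset.card_univ, Fintype.card_perm, Fintype.card_fin]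
  have hG : ∀ π, Measurable fun z : Matrix (Fin n) (Fin p) ℝ × Matrix (Fin n) (Fin m) ℝ =>
      ENNReal.ofReal (Real.exp (f (est.toFun z) π)) := fun π =>
    est.measurable_comp fun τ => ENNReal.ofReal (Real.exp (f τ π))
  have hbdd : ∀ (ψ : Matrix (Fin n) (Fin p) ℝ × Matrix (Fin n) (Fin m) ℝ →
      Matrix (Fin n) (Fin p) ℝ × Matrix (Fin n) (Fin m) ℝ), Measurable ψ →
      ∀ g : Equiv.Perm (Fin n) → ℝ, Integrable (fun z => g (est.toFun (ψ z)))
        (dataLaw n p m v) := fun ψ hψ g =>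
    Integrable.of_bound (((est.measurable_comp g).comp hψ).aestronglyMeasurable)
      (∑ τ, ‖g τ‖) (Filter.Eventually.of_forall fun z =>
        Finset.single_le_sum (f := fun τ => ‖g τ‖) (fun _ _ => norm_nonneg _)
          (Finset.mem_univ (est.toFun (ψ z))))
  have hψ1 : ∀ π : Equiv.Perm (Fin n), Measurable
      fun z : Matrix (Fin n) (Fin p) ℝ × Matrix (Fin n) (Fin m) ℝ =>
        (z.1, response B π z.1 z.2) := fun π => measurable_fst.prodMk (measurable_response B π)
  have hψ2 : Measurable fun z : Matrix (Fin n) (Fin p) ℝ × Matrix (Fin n) (Fin m) ℝ =>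
        (z.1, z.2 * A) := measurable_fst.prodMk (measurable_snd.matrix_mul measurable_const)
  have hF := fun π => hbdd _ (hψ1 π) fun τ => f τ π
  have hE := fun π => hbdd _ hψ2 fun τ => Real.exp (f τ π)
  have htilt : ∀ π, Integrable (fun z => Real.exp (f (est.toFun (z.1, response B π z.1 z.2)) π -
        logLikelihoodRatio B A v π z)) (dataLaw n p m v) ∧
      ∫ z, Real.exp (f (est.toFun (z.1, response B π z.1 z.2)) π -
        logLikelihoodRatio B A v π z) ∂dataLaw n p m v =
      ∫ z, Real.exp (f (est.toFun (z.1, z.2 * A)) π) ∂dataLaw n p m v := by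
    intro π
    have h := lintegral_mul_exp_neg_logLikelihoodRatio B hv hA0 π (hG π)
    have e : ∀ z : Matrix (Fin n) (Fin p) ℝ × Matrix (Fin n) (Fin m) ℝ,
        ENNReal.ofReal (Real.exp (f (est.toFun (z.1, response B π z.1 z.2)) π)) *
          ENNReal.ofReal (Real.exp (-logLikelihoodRatio B A v π z)) =
        ENNReal.ofReal (Real.exp (f (est.toFun (z.1, response B π z.1 z.2)) π -
          logLikelihoodRatio B A v π z)) := fun z => by
      rw [← ENNReal.ofReal_mul (Real.exp_nonneg _), ← Real.exp_add, sub_eq_add_neg]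
    simp only [e] at h
    have hmeas : AEStronglyMeasurable (fun z => Real.exp
        (f (est.toFun (z.1, response B π z.1 z.2)) π - logLikelihoodRatio B A v π z))
        (dataLaw n p m v) :=
      ((((est.measurable_comp fun τ => f τ π).comp (hψ1 π)).sub
        (measurable_logLikelihoodRatio B A v π)).exp).aestronglyMeasurable
    have h2 := ofReal_integral_eq_lintegral_ofReal (hE π)
      (Filter.Eventually.of_forall fun z => Real.exp_nonneg _)
    have hint : Integrable (fun z => Real.exp (f (est.toFun (z.1, response B π z.1 z.2)) π -
        logLikelihoodRatio B A v π z)) (dataLaw n p m v) := by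
      refine (lintegral_ofReal_ne_top_iff_integrable hmeas
        (Filter.Eventually.of_forall fun z => Real.exp_nonneg _)).1 ?_
      rw [h, ← h2]; exact ENNReal.ofReal_ne_top
    refine ⟨hint, ?_⟩
    rw [integral_eq_lintegral_of_nonneg_ae (Filter.Eventually.of_forall fun z => Real.exp_nonneg _)
      hmeas, h, integral_eq_lintegral_of_nonneg_ae
      (Filter.Eventually.of_forall fun z => Real.exp_nonneg _) (hE π).1]
  have hl := fun π : Equiv.Perm (Fin n) => integral_logLikelihoodRatio hv hA0 hA π
  -- Integrate `x + 1 ≤ exp x` at `x = f - logLikelihoodRatio - log K`. The likelihood ratio turns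
  -- the exponential into an integral under the reference law.
  have hstep : ∀ π, ∫ z, f (est.toFun (z.1, response B π z.1 z.2)) π ∂dataLaw n p m v -
        n * Real.log |A.det| - Real.log K ≤
      (∫ z, Real.exp (f (est.toFun (z.1, z.2 * A)) π) ∂dataLaw n p m v) / K - 1 := by
    intro π
    have hi1 := ((hF π).sub (hl π).1).sub (integrable_const (Real.log K))
    have hi2 := ((htilt π).1.div_const K).sub (integrable_const (1 : ℝ))
    have h := integral_mono hi1 hi2 fun z => by
      have h1 := Real.add_one_le_exp (f (est.toFun (z.1, response B π z.1 z.2)) π -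
        logLikelihoodRatio B A v π z - Real.log K)
      rw [Real.exp_sub _ (Real.log K), Real.exp_log hK] at h1
      simp only [Pi.sub_apply]
      linarith
    have e1 := integral_sub ((hF π).sub (hl π).1) (integrable_const (Real.log K))
    have e2 := integral_sub ((htilt π).1.div_const K) (integrable_const (1 : ℝ))
    have e3 := integral_sub (hF π) (hl π).1
    simp only [Pi.sub_apply] at h e1 e2 e3
    rw [e1, e2, e3, (hl π).2, integral_div, (htilt π).2] at h
    simpa using h
  have hsum := Finset.sum_le_sum fun π (_ : π ∈ Finset.univ) => hstep π
  -- Under the reference law the estimate no longer involves `π`, so the sum moves inside and `hf`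
  -- applies pointwise.
  have hQ : ∑ π, ∫ z, Real.exp (f (est.toFun (z.1, z.2 * A)) π) ∂dataLaw n p m v ≤
      (n ! : ℝ) * K := by
    rw [← integral_finsetSum _ fun π _ => hE π]
    calc _ ≤ ∫ _, (n ! : ℝ) * K ∂dataLaw n p m v :=
          integral_mono (integrable_finsetSum _ fun π _ => hE π) (integrable_const _)
            fun z => hf (est.toFun (z.1, z.2 * A))
      _ = _ := by simp
  simp only [Finset.sum_sub_distrib, Finset.sum_const, hcard, nsmul_eq_mul, ← Finset.sum_div]
    at hsum
  have h2 : (∑ π, ∫ z, Real.exp (f (est.toFun (z.1, z.2 * A)) π) ∂dataLaw n p m v) / K ≤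
      (n ! : ℝ) := (div_le_iff₀ hK).2 hQ
  linarith

/-! ### Counting permutations in Hamming balls -/

theorem permHamming_eq_card {n : ℕ} (τ π : Equiv.Perm (Fin n)) :
    permHamming τ π = (Finset.univ.filter fun i => τ i ≠ π i).card := by
  rw [permHamming, Finset.card_filter]

theorem permHamming_le {n : ℕ} (τ π : Equiv.Perm (Fin n)) : permHamming τ π ≤ n := by
  rw [permHamming_eq_card]
  exact (Finset.card_le_univ _).trans_eq (Fintype.card_fin n)

/-- Composing with `τ⁻¹` gives permutations that fix the complement of `S`, that is, permutations of
`S`. -/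
theorem card_perm_eqOn_compl {n : ℕ} (τ : Equiv.Perm (Fin n)) (S : Finset (Fin n)) :
    (Finset.univ.filter fun π : Equiv.Perm (Fin n) => ∀ i, i ∉ S → π i = τ i).card ≤ S.card ! := by
  have h : Fintype.card {f : Equiv.Perm (Fin n) // ∀ a, ¬ a ∈ S → f a = a} = S.card ! := by
    rw [← Fintype.card_congr (Equiv.Perm.subtypeEquivSubtypePerm fun a => a ∈ S),
      Fintype.card_perm, Fintype.card_coe]
  rw [← h, ← Fintype.card_subtype]
  refine Fintype.card_le_of_injective (fun π => ⟨τ⁻¹ * π.1, fun a ha => ?_⟩) ?_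
  · rw [Equiv.Perm.mul_apply, π.2 a ha]; exact τ.symm_apply_apply a
  · intro π₁ π₂ h
    exact Subtype.ext (mul_left_cancel (Subtype.ext_iff.1 h))

/-- The number of permutations in a Hamming ball. -/
theorem card_permHamming_le {n k : ℕ} (hk : k ≤ n) (τ : Equiv.Perm (Fin n)) :
    (Finset.univ.filter fun π => permHamming τ π ≤ k).card * (n - k)! ≤ n ! := by
  have hsub : (Finset.univ.filter fun π => permHamming τ π ≤ k) ⊆
      (Finset.powersetCard k Finset.univ).biUnion fun S =>
        Finset.univ.filter fun π : Equiv.Perm (Fin n) => ∀ i, i ∉ S → π i = τ i := by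
    intro π hπ
    rw [Finset.mem_filter, permHamming_eq_card] at hπ
    -- Enlarging the disagreement set to exactly `k` points lets the union run over `k`-subsets
    -- only, so the count is at most `n.choose k * k !`.
    obtain ⟨S, hS1, hS2⟩ := Finset.exists_superset_card_eq hπ.2 (by simpa using hk)
    refine Finset.mem_biUnion.2 ⟨S, Finset.mem_powersetCard.2 ⟨Finset.subset_univ _, hS2⟩, ?_⟩
    refine Finset.mem_filter.2 ⟨Finset.mem_univ _, fun i hi => ?_⟩
    by_contra hne
    exact hi (hS1 (Finset.mem_filter.2 ⟨Finset.mem_univ _, fun h => hne h.symm⟩))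
  have hcard : (Finset.univ.filter fun π => permHamming τ π ≤ k).card ≤ n.choose k * k ! := by
    refine (Finset.card_le_card hsub).trans (Finset.card_biUnion_le.trans ?_)
    refine (Finset.sum_le_card_nsmul _ _ (k !) fun S hS => ?_).trans_eq ?_
    · rw [← (Finset.mem_powersetCard.1 hS).2]; exact card_perm_eqOn_compl τ S
    · simp
  calc _ ≤ n.choose k * k ! * (n - k)! := Nat.mul_le_mul_right _ hcard
    _ = n ! := Nat.choose_mul_factorial_mul_factorial hk

/-- A disagreement at `i` forces a second one at `τ⁻¹ (π i)`. -/
theorem eq_of_permHamming_le_one {n : ℕ} {τ π : Equiv.Perm (Fin n)} (h : permHamming τ π ≤ 1) :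
    π = τ := by
  rw [permHamming_eq_card, Finset.card_le_one] at h
  by_contra hne
  obtain ⟨i, hi⟩ : ∃ i, π i ≠ τ i := by
    by_contra hcon; push Not at hcon; exact hne (Equiv.ext hcon)
  have hτ : τ (τ⁻¹ (π i)) = π i := τ.apply_symm_apply (π i)
  have hij : τ⁻¹ (π i) ≠ i := fun e => hi (by rw [← hτ, e])
  refine hij (h _ (Finset.mem_filter.2 ⟨Finset.mem_univ _, ?_⟩) i
    (Finset.mem_filter.2 ⟨Finset.mem_univ _, fun e => hi e.symm⟩))
  rw [hτ]
  exact fun e => hij (π.injective e).symm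

theorem card_permHamming_le_one {n k : ℕ} (hk : k ≤ 1) (τ : Equiv.Perm (Fin n)) :
    (Finset.univ.filter fun π => permHamming τ π ≤ k).card ≤ 1 :=
  Finset.card_le_one.2 fun a ha b hb => by
    rw [eq_of_permHamming_le_one ((Finset.mem_filter.1 ha).2.trans hk),
      eq_of_permHamming_le_one ((Finset.mem_filter.1 hb).2.trans hk)]

/-! ### Average risk, minimax risk and Fano's inequality -/

theorem PermEstimator.integrable_comp {n p m : ℕ} (est : PermEstimator n p m)
    (B : Matrix (Fin p) (Fin m) ℝ) (v : ℝ≥0) (π : Equiv.Perm (Fin n))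
    (g : Equiv.Perm (Fin n) → ℝ) :
    Integrable (fun z => g (est.toFun (z.1, response B π z.1 z.2))) (dataLaw n p m v) :=
  Integrable.of_bound (((est.measurable_comp g).comp
      (measurable_fst.prodMk (measurable_response B π))).aestronglyMeasurable)
    (∑ τ, ‖g τ‖) (Filter.Eventually.of_forall fun _ =>
      Finset.single_le_sum (f := fun τ => ‖g τ‖) (fun _ _ => norm_nonneg _) (Finset.mem_univ _))

/-- The minimax risk dominates the risk averaged over all permutations. -/
theorem ofReal_le_minimaxPermRisk {n p m : ℕ} (B : Matrix (Fin p) (Fin m) ℝ) (σ : ℝ)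
    {loss : Equiv.Perm (Fin n) → Equiv.Perm (Fin n) → ℝ≥0∞}
    {f : Equiv.Perm (Fin n) → Equiv.Perm (Fin n) → ℝ} (hf : ∀ τ π, 0 ≤ f τ π)
    (hloss : ∀ τ π, loss τ π = ENNReal.ofReal (f τ π)) {c : ℝ}
    (h : ∀ est : PermEstimator n p m, (n ! : ℝ) * c ≤
      ∑ π, ∫ z, f (est.toFun (z.1, response B π z.1 z.2)) π
        ∂dataLaw n p m (σ ^ 2).toNNReal) :
    ENNReal.ofReal c ≤ minimaxPermRisk n B σ loss := by
  refine le_iInf fun est => ?_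
  have hr : ∀ π, permRisk B σ loss est π = ENNReal.ofReal
      (∫ z, f (est.toFun (z.1, response B π z.1 z.2)) π ∂dataLaw n p m (σ ^ 2).toNNReal) := by
    intro π
    rw [permRisk, ofReal_integral_eq_lintegral_ofReal
      (est.integrable_comp B _ π fun τ => f τ π) (Filter.Eventually.of_forall fun z => hf _ _)]
    simp only [hloss]
  obtain ⟨π, -, hπ⟩ := Finset.exists_le_of_sum_le (s := Finset.univ)
    (f := fun _ : Equiv.Perm (Fin n) => c)
    (g := fun π => ∫ z, f (est.toFun (z.1, response B π z.1 z.2)) π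
      ∂dataLaw n p m (σ ^ 2).toNNReal) Finset.univ_nonempty (by
      simpa [Finset.card_univ, Fintype.card_perm] using h est)
  refine le_trans ?_ (le_iSup _ π)
  rw [hr]
  exact ENNReal.ofReal_le_ofReal hπ

theorem toNNReal_sq_pos {σ : ℝ} (hσ : 0 < σ) : 0 < (σ ^ 2).toNNReal :=
  Real.toNNReal_pos.2 (by positivity)

theorem sum_integral_le_logDetSNR {n p m : ℕ} (B : Matrix (Fin p) (Fin m) ℝ) {σ : ℝ} (hσ : 0 < σ)
    (est : PermEstimator n p m) (f : Equiv.Perm (Fin n) → Equiv.Perm (Fin n) → ℝ) {K : ℝ}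
    (hK : 0 < K) (hf : ∀ τ, ∑ π, Real.exp (f τ π) ≤ (n ! : ℝ) * K) :
    ∑ π, ∫ z, f (est.toFun (z.1, response B π z.1 z.2)) π ∂dataLaw n p m (σ ^ 2).toNNReal ≤
      (n ! : ℝ) * (n / 2 * logDetSNR B σ + Real.log K) := by
  obtain ⟨A, hA0, hA⟩ := exists_transpose_mul_self_eq B (sq_pos_of_pos hσ)
  rw [logDetSNR_eq hA]
  have hv : (((σ ^ 2).toNNReal : ℝ≥0) : ℝ) = σ ^ 2 := Real.coe_toNNReal _ (sq_nonneg σ)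
  rw [← hv] at hA
  refine (sum_integral_le_of_sum_exp_le B (toNNReal_sq_pos hσ) hA0 hA est f hK hf).trans_eq ?_
  ring

/-- Nonnegativity of relative entropy: the variational bound with `n = 1`, `f = 0`, `K = 1`. -/
theorem logDetSNR_nonneg {p m : ℕ} (B : Matrix (Fin p) (Fin m) ℝ) {σ : ℝ} (hσ : 0 < σ) :
    0 ≤ logDetSNR B σ := by
  have est : PermEstimator 1 p m := ⟨fun _ => 1, fun _ => MeasurableSet.const _⟩
  have h := sum_integral_le_logDetSNR B hσ est (fun _ _ => 0) one_pos (by simp)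
  simp at h
  linarith

/-- Fano's inequality for the probability of a small Hamming error. -/
theorem one_sub_le_average_permHamming_ge {n p m : ℕ} (B : Matrix (Fin p) (Fin m) ℝ) {σ : ℝ}
    (hσ : 0 < σ) (est : PermEstimator n p m) {D : ℕ} (hD : 1 ≤ D) (hDn : D ≤ n)
    (hM : 0 < Real.log ((n - D + 1)! : ℕ)) :
    (n ! : ℝ) * (1 - (n / 2 * logDetSNR B σ + Real.log 2) / Real.log ((n - D + 1)! : ℕ)) ≤
      ∑ π, ∫ z, (if D ≤ permHamming (est.toFun (z.1, response B π z.1 z.2)) π then (1 : ℝ) else 0)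
        ∂dataLaw n p m (σ ^ 2).toNNReal := by
  set M : ℕ := (n - D + 1)! with hMdef
  set t := Real.log M with ht
  have hMpos : (0 : ℝ) < M := by exact_mod_cast Nat.factorial_pos _
  have hM1 : (1 : ℝ) ≤ M := by exact_mod_cast Nat.factorial_pos _
  -- With `t = log M` the exponential is `M` on the ball of radius `D - 1` and `1` outside. The ball
  -- has at most `n!/M` elements, so each part contributes at most `n!`; hence `K = 2`.
  have key := sum_integral_le_logDetSNR B hσ est
    (fun τ π => t * (1 - if D ≤ permHamming τ π then (1 : ℝ) else 0)) (K := 2) two_pos (by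
    intro τ
    have e : ∀ π, Real.exp (t * (1 - if D ≤ permHamming τ π then (1 : ℝ) else 0)) =
        1 + (M - 1) * (if permHamming τ π ≤ D - 1 then (1 : ℝ) else 0) := by
      intro π
      by_cases h : D ≤ permHamming τ π
      · have h' : ¬ permHamming τ π ≤ D - 1 := by omega
        simp [h, h']
      · have h' : permHamming τ π ≤ D - 1 := by omega
        simp [h, h', ht, Real.exp_log hMpos]
    simp only [e, Finset.sum_add_distrib, ← Finset.mul_sum, Finset.sum_boole]
    have hc := card_permHamming_le (show D - 1 ≤ n by omega) τ
    rw [show n - (D - 1) = n - D + 1 by omega, ← hMdef] at hc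
    have hc' : ((Finset.univ.filter fun π => permHamming τ π ≤ D - 1).card : ℝ) * M ≤ (n ! : ℝ) := by
      exact_mod_cast hc
    have hc0 : (0 : ℝ) ≤ (Finset.univ.filter fun π => permHamming τ π ≤ D - 1).card :=
      Nat.cast_nonneg _
    simp only [Finset.sum_const, Finset.card_univ, Fintype.card_perm, Fintype.card_fin,
      nsmul_eq_mul, mul_one]
    nlinarith)
  have e : ∀ π, ∫ z, t * (1 - if D ≤ permHamming (est.toFun (z.1, response B π z.1 z.2)) π
      then (1 : ℝ) else 0) ∂dataLaw n p m (σ ^ 2).toNNReal =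
      t * (1 - ∫ z, (if D ≤ permHamming (est.toFun (z.1, response B π z.1 z.2)) π
        then (1 : ℝ) else 0) ∂dataLaw n p m (σ ^ 2).toNNReal) := by
    intro π
    rw [integral_const_mul, integral_sub (integrable_const _)
      (est.integrable_comp B _ π fun τ => if D ≤ permHamming τ π then (1 : ℝ) else 0)]
    simp
  simp only [e, ← Finset.mul_sum, Finset.sum_sub_distrib, Finset.sum_const, Finset.card_univ,
    Fintype.card_perm, Fintype.card_fin, nsmul_eq_mul, mul_one] at key
  set S := ∑ π, ∫ z, (if D ≤ permHamming (est.toFun (z.1, response B π z.1 z.2)) π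
        then (1 : ℝ) else 0) ∂dataLaw n p m (σ ^ 2).toNNReal
  have : (n ! : ℝ) - S ≤ (n ! : ℝ) * ((n / 2 * logDetSNR B σ + Real.log 2) / t) := by
    rw [← mul_div_assoc, le_div_iff₀ hM]; linarith
  linarith

theorem half_le_minimaxPermRisk {n p m : ℕ} (B : Matrix (Fin p) (Fin m) ℝ) {σ : ℝ}
    (hσ : 0 < σ) {D : ℕ} (hDn : D ≤ n)
    (h : logDetSNR B σ ≤ (Real.log ((n - D + 1)! : ℕ) - Real.log 4) / n) :
    1 / 2 ≤ minimaxPermRisk n B σ (fun τ π => if D ≤ permHamming τ π then 1 else 0) := by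
  have e12 : (1 / 2 : ℝ≥0∞) = ENNReal.ofReal (1 / 2) := by
    rw [ENNReal.ofReal_div_of_pos two_pos]; simp
  rw [e12]
  refine ofReal_le_minimaxPermRisk B σ
    (f := fun τ π => if D ≤ permHamming τ π then (1 : ℝ) else 0)
    (fun τ π => by positivity) (fun τ π => by split_ifs <;> simp) fun est => ?_
  rcases Nat.eq_zero_or_pos D with rfl | hD
  · simp [Fintype.card_perm]
    have : (0 : ℝ) ≤ (n ! : ℝ) := Nat.cast_nonneg _
    linarith
  · have hn : (0 : ℝ) < n := by exact_mod_cast (by omega : 0 < n)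
    have h1 := h
    rw [le_div_iff₀ hn] at h1
    have hL := logDetSNR_nonneg B hσ
    have h4 : Real.log 4 = 2 * Real.log 2 := by
      rw [show (4 : ℝ) = 2 ^ 2 by norm_num, Real.log_pow]; norm_num
    have hl2 : 0 < Real.log 2 := Real.log_pos one_lt_two
    have hM : 0 < Real.log ((n - D + 1)! : ℕ) := by
      have : 0 ≤ logDetSNR B σ * n := mul_nonneg hL hn.le
      linarith
    refine le_trans ?_ (one_sub_le_average_permHamming_ge B hσ est hD hDn hM)
    refine mul_le_mul_of_nonneg_left ?_ (Nat.cast_nonneg _)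
    -- As `log 4 = 2 log 2`, this is exactly half of the hypothesis.
    have : (n / 2 * logDetSNR B σ + Real.log 2) / Real.log ((n - D + 1)! : ℕ) ≤ 1 / 2 := by
      rw [div_le_iff₀ hM]; linarith
    linarith

/-! ### Exponential moments of the Hamming distance, for `1 ≤ d ≤ n - 2` -/

theorem sub_one_mul_pow_le {w : ℝ} (hw : 1 ≤ w) (i k : ℕ) :
    (k : ℝ) * ((w - 1) * w ^ i) ≤ w ^ (i + k) := by
  have h := one_add_mul_le_pow (a := w - 1) (by linarith) k
  have hwi : 0 ≤ w ^ i := by positivity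
  rw [add_sub_cancel] at h
  rw [pow_add]
  nlinarith

theorem sum_geometric_quarter_le (s : ℕ) :
    ∑ i ∈ Finset.range s, (1 / 4 : ℝ) ^ i ≤ 4 / 3 := by
  have h := geom_sum_eq (x := (1 / 4 : ℝ)) (by norm_num) s
  have : 0 ≤ (1 / 4 : ℝ) ^ s := by positivity
  rw [h, div_le_iff_of_neg (by norm_num)]
  linarith

/-- With `a = (j-1)!` one has `j! ≤ a (a + 1)`, which is below `(1 + a/2)^3`. -/
theorem sub_one_le_half_factorial {w : ℝ} {j : ℕ} (hj : 3 ≤ j)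
    (h : w ^ 3 ≤ (j ! : ℝ)) : w - 1 ≤ ((j - 1)! : ℝ) / 2 := by
  obtain ⟨i, rfl⟩ : ∃ i, j = i + 1 := ⟨j - 1, by omega⟩
  rw [Nat.factorial_succ, Nat.cast_mul] at h
  rw [Nat.add_sub_cancel]
  have ha : (i : ℝ) ≤ (i ! : ℝ) := by exact_mod_cast Nat.self_le_factorial i
  have ha1 : (1 : ℝ) ≤ (i ! : ℝ) := by exact_mod_cast Nat.factorial_pos i
  set a : ℝ := (i ! : ℝ)
  push_cast at h
  by_contra! hlt
  have h1 : (1 + a / 2) ^ 3 < w ^ 3 := by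
    refine pow_lt_pow_left₀ (by linarith) (by positivity) (by norm_num)
  have h2 : ((i : ℝ) + 1) * a ≤ (a + 1) * a := by gcongr
  nlinarith [sq_nonneg (a - 1), mul_nonneg (sq_nonneg (a - 1)) (by linarith : (0 : ℝ) ≤ a)]

/-- This is the Hamming-ball estimate of `sum_inv_pow_permHamming_le` divided by `n!`, with `n = j +
s`. The term `i = 0` is at most `1/2`, and the others are dominated by a geometric series of ratio
`1/4` and sum at most `4/9`. -/
theorem sum_sub_one_mul_pow_div_factorial_le {w : ℝ} {j s : ℕ} (hw : 1 ≤ w) (hj : 3 ≤ j)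
    (h : w ^ (s + 2) = (j ! : ℝ)) :
    (j ! : ℝ) / ((j + s)! : ℝ) - 1 / ((j + s)! : ℝ) +
      ∑ i ∈ Finset.range s, (w - 1) * w ^ i / ((j - 1 + i)! : ℝ) ≤ 1 := by
  have hpos : ∀ k : ℕ, (0 : ℝ) < (k ! : ℝ) := fun k => by exact_mod_cast Nat.factorial_pos k
  have hone : 0 ≤ 1 / ((j + s)! : ℝ) := by positivity
  have hj' : (3 : ℝ) ≤ j := by exact_mod_cast hj
  rcases s with _ | s
  · simp [div_self (hpos j).ne']
  have h0 : (w - 1) / ((j - 1)! : ℝ) ≤ 1 / 2 := by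
    rw [div_le_iff₀ (hpos _)]
    have := sub_one_le_half_factorial hj
      (h ▸ pow_le_pow_right₀ hw (by omega : 3 ≤ s + 1 + 2))
    linarith
  have hterm : ∀ i ∈ Finset.range s, (w - 1) * w ^ (i + 1) / ((j - 1 + (i + 1))! : ℝ) ≤
      1 / 3 * (1 / 4) ^ i := by
    intro i hi
    have hi' : i < s := Finset.mem_range.1 hi
    -- Bernoulli with at least three spare powers of `w` gives `j!/3`; the factorial in the
    -- denominator supplies the factor `4 ^ i`, since `j + 1 ≥ 4`.
    have h1 := sub_one_mul_pow_le hw (i + 1) (s + 2 - i)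
    rw [show i + 1 + (s + 2 - i) = s + 1 + 2 by omega, h] at h1
    have h3 : (3 : ℝ) ≤ ((s + 2 - i : ℕ) : ℝ) := by exact_mod_cast (by omega : 3 ≤ s + 2 - i)
    have h2 : 3 * ((w - 1) * w ^ (i + 1)) ≤ (j ! : ℝ) := by
      refine le_trans (mul_le_mul_of_nonneg_right h3 ?_) h1
      exact mul_nonneg (by linarith) (by positivity)
    have h4 : (j ! : ℝ) * 4 ^ i ≤ ((j + i)! : ℝ) := by
      have : j ! * 4 ^ i ≤ (j + i)! :=
        (Nat.mul_le_mul_left _ (Nat.pow_le_pow_left (by omega) i)).trans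
          (Nat.factorial_mul_pow_le_factorial (m := j) (n := i))
      exact_mod_cast this
    rw [show j - 1 + (i + 1) = j + i by omega, div_le_iff₀ (hpos _)]
    have h5 : 1 / 3 * (1 / 4 : ℝ) ^ i * ((j ! : ℝ) * 4 ^ i) = (j ! : ℝ) / 3 := by
      rw [one_div_pow]; field_simp
    have h6 : 1 / 3 * (1 / 4 : ℝ) ^ i * ((j ! : ℝ) * 4 ^ i) ≤
        1 / 3 * (1 / 4 : ℝ) ^ i * ((j + i)! : ℝ) := by gcongr
    linarith
  rw [Finset.sum_range_succ']
  have hsum := Finset.sum_le_sum hterm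
  rw [← Finset.mul_sum] at hsum
  simp only [add_zero, pow_zero, mul_one]
  have hgeo := sum_geometric_quarter_le s
  -- With one level left the geometric tail is empty and `1/2 + 1/4` suffices; otherwise the total
  -- is at most `1/2 + 4/9 + 1/20 < 1`.
  rcases s with _ | s
  · have : (j ! : ℝ) / ((j + (0 + 1))! : ℝ) ≤ 1 / 4 := by
      rw [zero_add, Nat.factorial_succ, div_le_iff₀ (by positivity)]
      push_cast
      nlinarith [hpos j]
    simp only [Finset.range_zero, Finset.sum_empty] at hsum ⊢
    linarith
  · have : (j ! : ℝ) / ((j + (s + 1 + 1))! : ℝ) ≤ 1 / 20 := by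
      rw [div_le_iff₀ (hpos _)]
      have h1 : ((j + 2)! : ℝ) ≤ ((j + (s + 1 + 1))! : ℝ) := by
        exact_mod_cast Nat.factorial_le (by omega)
      rw [Nat.factorial_succ, Nat.factorial_succ] at h1
      push_cast at h1
      have h2 : 20 * (j ! : ℝ) ≤ (j + 1 + 1) * ((j + 1) * (j ! : ℝ)) := by
        rw [← mul_assoc]
        exact mul_le_mul_of_nonneg_right (by nlinarith) (hpos j).le
      linarith
    linarith

/-- A telescoping, layer-cake form of the power: summed over permutations, it expresses the
exponential moment through cardinalities of Hamming balls. -/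
theorem pow_sub_eq_one_add_sum {w : ℝ} {d r : ℕ} (hd : d ≤ r) :
    w ^ (r - d) = 1 + ∑ k ∈ Finset.range r, if d ≤ k then (w - 1) * w ^ (r - 1 - k) else 0 := by
  induction r with
  | zero => simp
  | succ r ih =>
    rcases Nat.lt_or_ge r d with h | h
    · have : d = r + 1 := by omega
      subst this
      rw [Nat.sub_self, pow_zero, Finset.sum_eq_zero, add_zero]
      intro k hk
      rw [if_neg]
      have := Finset.mem_range.1 hk
      omega
    · rw [Finset.sum_range_succ, if_pos h, show r + 1 - d = (r - d) + 1 by omega, pow_succ, ih h]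
      have e : ∀ k ∈ Finset.range r, (if d ≤ k then (w - 1) * w ^ (r + 1 - 1 - k) else 0) =
          w * (if d ≤ k then (w - 1) * w ^ (r - 1 - k) else 0) := by
        intro k hk
        have := Finset.mem_range.1 hk
        split_ifs
        · rw [show r + 1 - 1 - k = (r - 1 - k) + 1 by omega, pow_succ]; ring
        · simp
      rw [Finset.sum_congr rfl e, ← Finset.mul_sum, show r + 1 - 1 - r = 0 by omega]
      ring

/-- An exponential moment bound for the Hamming distance to a uniform permutation. -/
theorem sum_inv_pow_permHamming_le {n j s : ℕ} (hj : 3 ≤ j) (hn : n = j + s) {w : ℝ} (hw : 1 ≤ w)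
    (h : w ^ (s + 2) = (j ! : ℝ)) (τ : Equiv.Perm (Fin n)) :
    ∑ π, (w ^ permHamming τ π)⁻¹ ≤ (n ! : ℝ) * (2 / (j ! : ℝ)) := by
  have hpos : ∀ k : ℕ, (0 : ℝ) < (k ! : ℝ) := fun k => by exact_mod_cast Nat.factorial_pos k
  have hw0 : 0 < w := by linarith
  set r := s + 2 with hr
  set N : ℕ → ℝ := fun k => ((Finset.univ.filter fun π => permHamming τ π ≤ k).card : ℝ) with hN
  have h1 : ∀ π, (j ! : ℝ) * (w ^ permHamming τ π)⁻¹ ≤ 1 + ∑ k ∈ Finset.range r,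
      if permHamming τ π ≤ k then (w - 1) * w ^ (r - 1 - k) else 0 := by
    intro π
    rcases le_total (permHamming τ π) r with hle | hle
    · rw [← pow_sub_eq_one_add_sum hle, ← h, pow_sub₀ _ hw0.ne' hle]
    · have : (j ! : ℝ) * (w ^ permHamming τ π)⁻¹ ≤ 1 := by
        rw [← h, ← div_eq_mul_inv, div_le_one (by positivity)]
        exact pow_le_pow_right₀ hw hle
      refine this.trans (le_add_of_nonneg_right (Finset.sum_nonneg fun k _ => ?_))
      split_ifs
      · exact mul_nonneg (by linarith) (by positivity)
      · exact le_rfl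
  have h2 : (j ! : ℝ) * ∑ π, (w ^ permHamming τ π)⁻¹ ≤
      (n ! : ℝ) + ∑ k ∈ Finset.range r, N k * ((w - 1) * w ^ (r - 1 - k)) := by
    rw [Finset.mul_sum]
    refine (Finset.sum_le_sum fun π _ => h1 π).trans_eq ?_
    rw [Finset.sum_add_distrib, Finset.sum_comm]
    congr 1
    · simp [Finset.card_univ, Fintype.card_perm]
    · refine Finset.sum_congr rfl fun k _ => ?_
      rw [← Finset.sum_filter, Finset.sum_const, nsmul_eq_mul]
  -- At radius `1` the general bound would give `n`; this improvement is what makes room for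
  -- `(n-d+1)!`.
  have hN1 : ∀ k ≤ 1, N k ≤ 1 := fun k hk => by
    simp only [hN]
    exact_mod_cast card_permHamming_le_one hk τ
  have hNk : ∀ k ≤ n, N k ≤ (n ! : ℝ) / ((n - k)! : ℝ) := fun k hk => by
    rw [le_div_iff₀ (hpos _)]
    simp only [hN]
    exact_mod_cast card_permHamming_le hk τ
  have hw1 : 0 ≤ w - 1 := by linarith
  have h3 : ∑ k ∈ Finset.range r, N k * ((w - 1) * w ^ (r - 1 - k)) ≤ (n ! : ℝ) := by
    rw [hr, Finset.sum_range_succ', Finset.sum_range_succ']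
    -- The two lowest levels telescope to `w ^ (s + 2) - w ^ s`, and `w ^ s ≥ 1`.
    have e0 : N 0 * ((w - 1) * w ^ (s + 2 - 1 - 0)) + N (0 + 1) * ((w - 1) * w ^ (s + 2 - 1 - (0 + 1)))
        ≤ (j ! : ℝ) - 1 := by
      have a0 : N 0 * ((w - 1) * w ^ (s + 2 - 1 - 0)) ≤ 1 * ((w - 1) * w ^ (s + 2 - 1 - 0)) :=
        mul_le_mul_of_nonneg_right (hN1 0 (by norm_num)) (mul_nonneg hw1 (by positivity))
      have a1 : N (0 + 1) * ((w - 1) * w ^ (s + 2 - 1 - (0 + 1))) ≤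
          1 * ((w - 1) * w ^ (s + 2 - 1 - (0 + 1))) :=
        mul_le_mul_of_nonneg_right (hN1 _ (by norm_num)) (mul_nonneg hw1 (by positivity))
      have a2 : (1 : ℝ) ≤ w ^ s := one_le_pow₀ hw
      rw [show s + 2 - 1 - (0 + 1) = s by omega] at *
      rw [show s + 2 - 1 - 0 = s + 1 by omega] at *
      rw [← h]
      have : w ^ (s + 2) - w ^ s = 1 * ((w - 1) * w ^ (s + 1)) + 1 * ((w - 1) * w ^ s) := by ring
      linarith
    have e1 : ∑ k ∈ Finset.range s, N (k + 1 + 1) * ((w - 1) * w ^ (s + 2 - 1 - (k + 1 + 1))) ≤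
        ∑ i ∈ Finset.range s, (n ! : ℝ) * ((w - 1) * w ^ i / ((j - 1 + i)! : ℝ)) := by
      rw [← Finset.sum_range_reflect]
      refine Finset.sum_le_sum fun i hi => ?_
      have hi' := Finset.mem_range.1 hi
      rw [show s + 2 - 1 - (s - 1 - i + 1 + 1) = i by omega]
      have a := hNk (s - 1 - i + 1 + 1) (by omega)
      rw [show n - (s - 1 - i + 1 + 1) = j - 1 + i by omega] at a
      refine (mul_le_mul_of_nonneg_right a (mul_nonneg hw1 (by positivity))).trans_eq ?_
      ring
    have e2 := sum_sub_one_mul_pow_div_factorial_le hw hj h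
    rw [← hn] at e2
    have e3 := mul_le_mul_of_nonneg_left e2 (hpos n).le
    rw [mul_add, mul_sub, mul_div_cancel₀ _ (hpos n).ne', mul_div_cancel₀ _ (hpos n).ne',
      Finset.mul_sum] at e3
    linarith
  rw [← mul_div_assoc, le_div_iff₀ (hpos j)]
  linarith

theorem le_average_permHamming_of_pos {n p m : ℕ} (B : Matrix (Fin p) (Fin m) ℝ) {σ : ℝ}
    (hσ : 0 < σ) (est : PermEstimator n p m) {d : ℕ} (hd : 1 ≤ d) (hdn : d + 2 ≤ n) :
    (n ! : ℝ) * (((d : ℝ) + 1) *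
      (1 - ((n : ℝ) / 2 * logDetSNR B σ + Real.log 2) / Real.log ((n - d + 1)! : ℕ))) ≤
      ∑ π, ∫ z, (permHamming (est.toFun (z.1, response B π z.1 z.2)) π : ℝ)
        ∂dataLaw n p m (σ ^ 2).toNNReal := by
  set M : ℕ := (n - d + 1)! with hM
  have hMpos : (0 : ℝ) < M := by exact_mod_cast Nat.factorial_pos _
  have hM1 : (1 : ℝ) < M := by
    exact_mod_cast (Nat.one_lt_factorial.2 (by omega) : 1 < (n - d + 1)!)
  have hlog : 0 < Real.log M := Real.log_pos hM1
  have hd1 : (0 : ℝ) < (d : ℝ) + 1 := by positivity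
  -- Chosen so that dividing the variational bound by `t` produces the prefactor `d + 1`; then `exp
  -- t ^ (d + 1) = M`.
  set t : ℝ := Real.log M / (d + 1) with ht
  have ht0 : 0 < t := div_pos hlog hd1
  have hpow : Real.exp t ^ (d - 1 + 2) = ((n - d + 1)! : ℝ) := by
    rw [← Real.exp_nat_mul, show d - 1 + 2 = d + 1 by omega, ht, Nat.cast_add, Nat.cast_one,
      mul_div_cancel₀ _ hd1.ne', Real.exp_log hMpos]
  have key := sum_integral_le_logDetSNR B hσ est
    (fun τ π => -t * (permHamming τ π : ℝ)) (K := 2 / M) (by positivity) (by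
    intro τ
    have h := sum_inv_pow_permHamming_le (n := n) (j := n - d + 1) (s := d - 1) (by omega)
      (by omega) (Real.one_le_exp ht0.le) hpow τ
    refine le_trans (le_of_eq ?_) h
    refine Finset.sum_congr rfl fun π _ => ?_
    rw [neg_mul, Real.exp_neg, mul_comm, Real.exp_nat_mul])
  simp only [integral_const_mul, ← Finset.mul_sum] at key
  rw [Real.log_div two_ne_zero hMpos.ne'] at key
  set S := ∑ π, ∫ z, (permHamming (est.toFun (z.1, response B π z.1 z.2)) π : ℝ)
        ∂dataLaw n p m (σ ^ 2).toNNReal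
  have e : (n ! : ℝ) * (((d : ℝ) + 1) *
      (1 - ((n : ℝ) / 2 * logDetSNR B σ + Real.log 2) / Real.log M)) =
      (n ! : ℝ) * (Real.log M - (n : ℝ) / 2 * logDetSNR B σ - Real.log 2) / t := by
    rw [ht]; field_simp; ring
  rw [e, div_le_iff₀ ht0]
  linarith

/-! ### Le Cam's method for transpositions -/

theorem frobSq_eq_trace_mul_transpose {k l : ℕ} (x : Matrix (Fin k) (Fin l) ℝ) :
    frobSq x = (x * x.transpose).trace := by
  simp only [frobSq, Matrix.trace, Matrix.diag, Matrix.mul_apply, Matrix.transpose_apply, sq]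

theorem frobInner_mul_mul {n p m r : ℕ} (P : Matrix (Fin r) (Fin n) ℝ)
    (x : Matrix (Fin n) (Fin p) ℝ) (B : Matrix (Fin p) (Fin m) ℝ) (w : Matrix (Fin r) (Fin m) ℝ) :
    frobInner (P * x * B) w = frobInner (P.transpose * w * B.transpose) x := by
  have e : ∀ {k l : ℕ} (a b : Matrix (Fin k) (Fin l) ℝ),
      frobInner a b = (a.transpose * b).trace := fun a b => by
    simp only [frobInner, Matrix.trace, Matrix.diag, Matrix.mul_apply, Matrix.transpose_apply]
    rw [Finset.sum_comm]
  rw [e, e, ← Matrix.trace_transpose]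
  simp only [Matrix.transpose_mul, Matrix.transpose_transpose]
  rw [← Matrix.mul_assoc, ← Matrix.mul_assoc, Matrix.trace_mul_comm]
  simp only [Matrix.mul_assoc]

theorem exp_neg_half_logDetSNR {p m : ℕ} {B : Matrix (Fin p) (Fin m) ℝ} {σ : ℝ}
    {A : Matrix (Fin m) (Fin m) ℝ} (hA0 : A.det ≠ 0)
    (hA : A.transpose * A = 1 + (σ ^ 2)⁻¹ • (B.transpose * B)) :
    Real.exp (-(logDetSNR B σ / 2)) = |A.det|⁻¹ := by
  rw [logDetSNR_eq hA, mul_div_cancel_left₀ _ two_ne_zero, Real.exp_neg,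
    Real.exp_log (abs_pos.2 hA0)]

/-- Since `|w Aᵀ|² = |w|² + |w Bᵀ|²/σ²`, the integrand times `|det A|` is the Jacobian weight of the
substitution by `(Aᵀ)⁻¹`, which has total mass one. -/
theorem integral_exp_neg_frobSq_mul_transpose {p m : ℕ} (B : Matrix (Fin p) (Fin m) ℝ) {σ : ℝ}
    (hσ : 0 < σ) :
    ∫ w : Matrix (Fin 1) (Fin m) ℝ, Real.exp (-(frobSq (w * B.transpose) / (2 * σ ^ 2)))
      ∂gaussianMatrix 1 m 1 = Real.exp (-(logDetSNR B σ / 2)) := by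
  obtain ⟨A, hA0, hA⟩ := exists_transpose_mul_self_eq B (sq_pos_of_pos hσ)
  have hu : IsUnit A.transpose.det := by
    rw [Matrix.det_transpose]; exact isUnit_iff_ne_zero.2 hA0
  rw [exp_neg_half_logDetSNR hA0 hA]
  have hdet : (A.transpose⁻¹).det = A.det⁻¹ := by
    rw [Matrix.det_nonsing_inv, Matrix.det_transpose, Ring.inverse_eq_inv']
  have h := lintegral_gaussianMatrix_mul 1 one_ne_zero (A := A.transpose⁻¹)
    (by rw [hdet]; exact inv_ne_zero hA0) 0 (g := fun _ => 1) measurable_const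
  have e : ∀ w : Matrix (Fin 1) (Fin m) ℝ, |(A.transpose⁻¹).det ^ 1|⁻¹ *
      Real.exp ((frobSq w - frobSq ((w + 0) * (A.transpose⁻¹)⁻¹)) / (2 * (1 : ℝ≥0))) =
      |A.det| * Real.exp (-(frobSq (w * B.transpose) / (2 * σ ^ 2))) := by
    intro w
    have e1 : frobSq (w * A.transpose) = frobSq w + (σ ^ 2)⁻¹ * frobSq (w * B.transpose) := by
      simp only [frobSq_eq_trace_mul_transpose, Matrix.transpose_mul, Matrix.transpose_transpose]
      rw [Matrix.mul_assoc, ← Matrix.mul_assoc A.transpose, hA, Matrix.add_mul, Matrix.mul_add,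
        Matrix.trace_add, Matrix.one_mul, Matrix.smul_mul, Matrix.mul_smul, Matrix.trace_smul,
        smul_eq_mul]
      simp only [Matrix.mul_assoc]
    rw [hdet, Matrix.nonsing_inv_nonsing_inv _ hu, add_zero, e1, pow_one, abs_inv, inv_inv]
    congr 2
    simp only [NNReal.coe_one]
    field_simp
    ring
  simp only [e, one_mul, lintegral_const, measure_univ] at h
  have hm : Measurable fun w : Matrix (Fin 1) (Fin m) ℝ =>
      Real.exp (-(frobSq (w * B.transpose) / (2 * σ ^ 2))) :=
    (((Measurable.frobSq (measurable_id.matrix_mul measurable_const)).div_const _).neg).exp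
  simp only [ENNReal.ofReal_mul (abs_nonneg A.det)] at h
  rw [lintegral_const_mul _ hm.ennreal_ofReal] at h
  rw [integral_eq_lintegral_of_nonneg_ae (Filter.Eventually.of_forall fun _ => Real.exp_nonneg _)
    hm.aestronglyMeasurable]
  have h2 := congrArg ENNReal.toReal h
  rw [ENNReal.toReal_mul, ENNReal.toReal_ofReal (abs_nonneg _), ENNReal.toReal_one] at h2
  exact eq_inv_of_mul_eq_one_right h2.symm

/-- The characteristic function of the difference of two rows, and Fubini. -/
theorem integral_exp_neg_frobSq_mul {n p m : ℕ} (B : Matrix (Fin p) (Fin m) ℝ) {σ : ℝ}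
    (hσ : 0 < σ) (E : Matrix (Fin 1) (Fin n) ℝ) (hE : E * E.transpose = (2 : ℝ) • 1) :
    ∫ x, Real.exp (-(frobSq (E * x * B) / (4 * σ ^ 2))) ∂gaussianMatrix n p 1 =
      Real.exp (-(logDetSNR B σ / 2)) := by
  have hs : 0 < σ ^ 2 := by positivity
  -- The integrand is the characteristic function of a standard Gaussian `w` at `s • (E * x * B)`,
  -- as `s²/2 = 1/(4σ²)`. Integrating `x` out first leaves a Gaussian integral over `w`, in which `E
  -- Eᵀ = 2` cancels the extra factor.
  set s : ℝ := (√2 * σ)⁻¹ with hsdef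
  have hs2 : s ^ 2 = 1 / (2 * σ ^ 2) := by
    rw [hsdef, inv_pow, mul_pow, Real.sq_sqrt zero_le_two, one_div]
  have hjm : Measurable fun z : Matrix (Fin n) (Fin p) ℝ × Matrix (Fin 1) (Fin m) ℝ =>
      frobInner (s • (E * z.1 * B)) z.2 := by
    simp only [frobInner_smul_left]
    exact (Measurable.frobInner ((measurable_const.matrix_mul measurable_fst).matrix_mul
      measurable_const) measurable_snd).const_mul s
  have hint : Integrable (Function.uncurry fun (x : Matrix (Fin n) (Fin p) ℝ)
      (w : Matrix (Fin 1) (Fin m) ℝ) => Complex.exp (frobInner (s • (E * x * B)) w * Complex.I))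
      ((gaussianMatrix n p 1).prod (gaussianMatrix 1 m 1)) := by
    refine Integrable.of_bound (C := 1) ?_ (Filter.Eventually.of_forall fun z =>
      (Complex.norm_exp_ofReal_mul_I _).le)
    exact (((Complex.measurable_ofReal.comp hjm).mul_const Complex.I).cexp).aestronglyMeasurable
  have hswap := integral_integral_swap hint
  have hx : ∀ x : Matrix (Fin n) (Fin p) ℝ,
      ∫ w, Complex.exp (frobInner (s • (E * x * B)) w * Complex.I) ∂gaussianMatrix 1 m 1 =
      ((Real.exp (-(frobSq (E * x * B) / (4 * σ ^ 2))) : ℝ) : ℂ) := by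
    intro x
    rw [integral_cexp_frobInner, frobSq_smul, hs2, ← Complex.ofReal_neg, ← Complex.ofReal_exp]
    congr 2
    simp only [NNReal.coe_one]
    field_simp
    ring
  have hw : ∀ w : Matrix (Fin 1) (Fin m) ℝ,
      ∫ x, Complex.exp (frobInner (s • (E * x * B)) w * Complex.I) ∂gaussianMatrix n p 1 =
      ((Real.exp (-(frobSq (w * B.transpose) / (2 * σ ^ 2))) : ℝ) : ℂ) := by
    intro w
    have e : ∀ x : Matrix (Fin n) (Fin p) ℝ, frobInner (s • (E * x * B)) w =
        frobInner (s • (E.transpose * w * B.transpose)) x := fun x => by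
      rw [frobInner_smul_left, frobInner_smul_left, frobInner_mul_mul]
    have e2 : frobSq (E.transpose * w * B.transpose) = 2 * frobSq (w * B.transpose) := by
      rw [frobSq_eq_trace, Matrix.mul_assoc, Matrix.transpose_mul, Matrix.transpose_transpose,
        Matrix.mul_assoc, ← Matrix.mul_assoc E, hE, Matrix.smul_mul, Matrix.one_mul,
        Matrix.mul_smul, Matrix.trace_smul, smul_eq_mul, ← frobSq_eq_trace]
    simp only [e]
    rw [integral_cexp_frobInner, frobSq_smul, hs2, e2, ← Complex.ofReal_neg, ← Complex.ofReal_exp]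
    congr 2
    simp only [NNReal.coe_one]
    field_simp
  simp only [hx, hw] at hswap
  rw [integral_complex_ofReal, integral_complex_ofReal] at hswap
  rw [Complex.ofReal_injective hswap, integral_exp_neg_frobSq_mul_transpose B hσ]

theorem integral_exp_neg_mul_sq_gaussianReal {a : ℝ} (ha : 0 ≤ a) :
    ∫ h, Real.exp (-(a * h ^ 2 / 2)) ∂gaussianReal 0 1 = (√(1 + a))⁻¹ := by
  rw [integral_gaussianReal_eq_integral_smul one_ne_zero]
  have e : ∀ x : ℝ, gaussianPDFReal 0 1 x • Real.exp (-(a * x ^ 2 / 2)) =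
      (√(2 * Real.pi))⁻¹ * Real.exp (-((1 + a) / 2) * x ^ 2) := by
    intro x
    simp only [gaussianPDFReal, NNReal.coe_one, smul_eq_mul, sub_zero, mul_one]
    rw [mul_assoc, ← Real.exp_add]
    congr 2
    ring
  simp only [e]
  rw [integral_const_mul, integral_gaussian, ← Real.sqrt_inv, ← Real.sqrt_mul (by positivity),
    ← Real.sqrt_inv]
  congr 1
  have := Real.pi_pos
  field_simp

/-- The inequality `|u| ≤ 1/(2η) + η u²/2`. It replaces the likelihood minimum by a Gaussian factor
that integrates explicitly; `η` is left free to be tuned. -/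
theorem exp_neg_abs_ge {η : ℝ} (hη : 0 < η) (u : ℝ) :
    Real.exp (-(1 / (2 * η))) * Real.exp (-(η * u ^ 2 / 2)) ≤ Real.exp (-|u|) := by
  rw [← Real.exp_add, Real.exp_le_exp]
  have h : |u| ≤ 1 / (2 * η) + η * u ^ 2 / 2 := by
    have h1 : 0 ≤ (η * |u| - 1) ^ 2 / (2 * η) := by positivity
    have h2 : (η * |u| - 1) ^ 2 / (2 * η) = 1 / (2 * η) + η * u ^ 2 / 2 - |u| := by
      rw [← sq_abs u]; field_simp; ring
    linarith
  linarith

theorem lintegral_exp_neg_frobInner_sq {k l : ℕ} {v : ℝ≥0} (hv : 0 < v)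
    (η : ℝ) (δ : Matrix (Fin k) (Fin l) ℝ) :
    ∫⁻ z, ENNReal.ofReal (Real.exp (-(η * (frobInner δ z / v) ^ 2 / 2))) ∂gaussianMatrix k l v =
      ∫⁻ h, ENNReal.ofReal (Real.exp (-(η * (frobSq δ / v) * h ^ 2 / 2))) ∂gaussianReal 0 1 := by
  have hvr : (0 : ℝ) < v := by exact_mod_cast hv
  have hm : Measurable fun y : ℝ => ENNReal.ofReal (Real.exp (-(η * (y / v) ^ 2 / 2))) := by
    fun_prop
  have h1 := lintegral_map hm (measurable_frobInner_left δ) (μ := gaussianMatrix k l v)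
  have h0 : 0 ≤ v * frobSq δ := mul_nonneg hvr.le (frobSq_nonneg δ)
  have h2 : (gaussianReal 0 1).map (fun y => √(v * frobSq δ) * y) =
      gaussianReal 0 (v * (frobSq δ).toNNReal) := by
    rw [gaussianReal_map_const_mul, mul_zero]
    congr 1
    ext
    simp only [NNReal.coe_mul, NNReal.coe_mk, mul_one,
      Real.coe_toNNReal _ (frobSq_nonneg δ)]
    exact Real.sq_sqrt h0
  rw [map_frobInner_gaussianMatrix, ← h2, lintegral_map hm (by fun_prop)] at h1
  rw [← h1]
  refine lintegral_congr fun h => ?_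
  congr 3
  rw [div_pow, mul_pow, Real.sq_sqrt h0]
  field_simp

theorem frobInner_neg_right {k l : ℕ} (x y : Matrix (Fin k) (Fin l) ℝ) :
    frobInner x (-y) = -frobInner x y := by
  simp [frobInner]

theorem frobSq_neg {k l : ℕ} (x : Matrix (Fin k) (Fin l) ℝ) : frobSq (-x) = frobSq x := by
  simp [frobSq]

theorem frobInner_comm {k l : ℕ} (x y : Matrix (Fin k) (Fin l) ℝ) :
    frobInner x y = frobInner y x := by
  simp [frobInner, mul_comm]

/-- Le Cam's two-point bound for two Gaussian shifts. -/
theorem lintegral_add_lintegral_ge {k l : ℕ} {v : ℝ≥0} (hv : 0 < v) {η : ℝ} (hη : 0 < η)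
    (μ₁ μ₂ : Matrix (Fin k) (Fin l) ℝ) {g₁ g₂ : Matrix (Fin k) (Fin l) ℝ → ℝ≥0∞}
    (hg₁ : Measurable g₁) (hg₂ : Measurable g₂) (hg : ∀ y, 1 ≤ g₁ y + g₂ y) :
    ∫⁻ h, ENNReal.ofReal (Real.exp (-(1 / (2 * η))) * Real.exp (-((1 + η * h ^ 2) *
        (frobSq ((2 : ℝ)⁻¹ • (μ₁ - μ₂)) / v / 2)))) ∂gaussianReal 0 1 ≤
      ∫⁻ w, g₁ (μ₁ + w) ∂gaussianMatrix k l v + ∫⁻ w, g₂ (μ₂ + w) ∂gaussianMatrix k l v := by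
  have hvr : (0 : ℝ) < v := by exact_mod_cast hv
  set δ := (2 : ℝ)⁻¹ • (μ₁ - μ₂) with hδ
  -- Centring at the midpoint makes the two shifts `δ` and `-δ`, so their likelihoods are `exp (±u -
  -- q/2)`, with minimum `exp (-|u| - q/2)`.
  set c := (2 : ℝ)⁻¹ • (μ₁ + μ₂) with hc
  have e1 : ∀ w, μ₁ + w = (w + δ) + c := fun w => by
    ext i j; simp [hδ, hc]; ring
  have e2 : ∀ w, μ₂ + w = (w + -δ) + c := fun w => by
    ext i j; simp [hδ, hc]; ring
  have hsm : Measurable fun z : Matrix (Fin k) (Fin l) ℝ => z + c :=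
    measurable_id.matrix_add measurable_const
  have hum : Measurable fun z : Matrix (Fin k) (Fin l) ℝ => frobInner δ z / v :=
    (measurable_frobInner_left δ).div_const _
  simp only [e1, e2]
  rw [lintegral_gaussianMatrix_add hv.ne' δ (g := fun z => g₁ (z + c)) (hg₁.comp hsm),
    lintegral_gaussianMatrix_add hv.ne' (-δ) (g := fun z => g₂ (z + c)) (hg₂.comp hsm)]
  set q := frobSq δ / v with hq
  have hbound : ∀ z : Matrix (Fin k) (Fin l) ℝ,
      ENNReal.ofReal (Real.exp (-(1 / (2 * η))) * Real.exp (-(q / 2))) *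
        ENNReal.ofReal (Real.exp (-(η * (frobInner δ z / v) ^ 2 / 2))) ≤
      g₁ (z + c) * ENNReal.ofReal (Real.exp (frobInner z δ / v - frobSq δ / (2 * v))) +
      g₂ (z + c) * ENNReal.ofReal (Real.exp (frobInner z (-δ) / v - frobSq (-δ) / (2 * v))) := by
    intro z
    have hd : frobSq δ / (2 * v) = q / 2 := by rw [hq]; field_simp
    rw [frobInner_neg_right, frobSq_neg, hd, frobInner_comm z δ, neg_div]
    set u := frobInner δ z / v
    set H := ENNReal.ofReal (Real.exp (-|u| - q / 2)) with hH
    have h0 : ENNReal.ofReal (Real.exp (-(1 / (2 * η))) * Real.exp (-(q / 2))) *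
        ENNReal.ofReal (Real.exp (-(η * u ^ 2 / 2))) ≤ H := by
      rw [← ENNReal.ofReal_mul (by positivity)]
      refine ENNReal.ofReal_le_ofReal ?_
      rw [sub_eq_add_neg, Real.exp_add, mul_right_comm]
      exact mul_le_mul_of_nonneg_right (exp_neg_abs_ge hη u) (Real.exp_nonneg _)
    have h1 : H ≤ ENNReal.ofReal (Real.exp (u - q / 2)) :=
      ENNReal.ofReal_le_ofReal (Real.exp_le_exp.2 (by linarith [neg_abs_le u]))
    have h2 : H ≤ ENNReal.ofReal (Real.exp (-u - q / 2)) :=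
      ENNReal.ofReal_le_ofReal (Real.exp_le_exp.2 (by linarith [le_abs_self u]))
    calc _ ≤ 1 * H := by rwa [one_mul]
      _ ≤ (g₁ (z + c) + g₂ (z + c)) * H := by gcongr; exact hg _
      _ = g₁ (z + c) * H + g₂ (z + c) * H := add_mul _ _ _
      _ ≤ _ := by gcongr
  rw [← lintegral_add_left]
  swap
  · refine (hg₁.comp hsm).mul ?_
    exact ((((Measurable.frobInner measurable_id measurable_const).div_const _).sub_const
      _).exp).ennreal_ofReal
  refine le_trans (le_of_eq ?_) (lintegral_mono hbound)
  have hem : Measurable fun z : Matrix (Fin k) (Fin l) ℝ =>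
      ENNReal.ofReal (Real.exp (-(η * (frobInner δ z / v) ^ 2 / 2))) :=
    (((hum.pow_const 2).const_mul η).div_const 2).neg.exp.ennreal_ofReal
  rw [lintegral_const_mul _ hem,
    lintegral_exp_neg_frobInner_sq hv, ← lintegral_const_mul _ (by fun_prop)]
  refine lintegral_congr fun h => ?_
  rw [← ENNReal.ofReal_mul (by positivity)]
  simp only [← Real.exp_add]
  congr 2
  ring

/-- Averaging the two-point bound over the design. -/
theorem lintegral_lintegral_exp_ge {n p m : ℕ} (B : Matrix (Fin p) (Fin m) ℝ) {σ : ℝ}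
    (hσ : 0 < σ) (E : Matrix (Fin 1) (Fin n) ℝ) (hE : E * E.transpose = (2 : ℝ) • 1) {η : ℝ}
    (hη : 0 < η) :
    ENNReal.ofReal (Real.exp (-(1 / (2 * η))) * (Real.exp (-(logDetSNR B σ / 2)) *
        (√(1 + η * logDetSNR B σ))⁻¹)) ≤
      ∫⁻ x, ∫⁻ h, ENNReal.ofReal (Real.exp (-(1 / (2 * η))) * Real.exp (-((1 + η * h ^ 2) *
        (frobSq (E * x * B) / (4 * σ ^ 2))))) ∂gaussianReal 0 1 ∂gaussianMatrix n p 1 := by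
  set L := logDetSNR B σ with hL
  have hL0 : 0 ≤ L := logDetSNR_nonneg B hσ
  have hqm : Measurable fun x : Matrix (Fin n) (Fin p) ℝ => frobSq (E * x * B) / (4 * σ ^ 2) :=
    (Measurable.frobSq ((measurable_const.matrix_mul measurable_id).matrix_mul
      measurable_const)).div_const _
  have hq0 : ∀ x : Matrix (Fin n) (Fin p) ℝ, 0 ≤ frobSq (E * x * B) / (4 * σ ^ 2) := fun x =>
    div_nonneg (frobSq_nonneg _) (by positivity)
  have hbdd : ∀ {a : ℝ}, 0 ≤ a → Integrable (fun x : Matrix (Fin n) (Fin p) ℝ =>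
      Real.exp (-(a * (frobSq (E * x * B) / (4 * σ ^ 2))))) (gaussianMatrix n p 1) := fun ha =>
    Integrable.of_bound ((hqm.const_mul _).neg.exp.aestronglyMeasurable) 1
      (Filter.Eventually.of_forall fun x => by
        rw [Real.norm_of_nonneg (Real.exp_nonneg _), Real.exp_le_one_iff]
        linarith [mul_nonneg ha (hq0 x)])
  have hjm : Measurable fun z : Matrix (Fin n) (Fin p) ℝ × ℝ =>
      ENNReal.ofReal (Real.exp (-(1 / (2 * η))) * Real.exp (-((1 + η * z.2 ^ 2) *
        (frobSq (E * z.1 * B) / (4 * σ ^ 2))))) :=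
    (((((measurable_snd.pow_const 2).const_mul η).const_add 1).mul
      (hqm.comp measurable_fst)).neg.exp.const_mul _).ennreal_ofReal
  rw [lintegral_lintegral_swap hjm.aemeasurable]
  have hinner : ∀ h : ℝ, ENNReal.ofReal (Real.exp (-(1 / (2 * η))) *
      Real.exp (-((1 + η * h ^ 2) * (L / 2)))) ≤
      ∫⁻ x, ENNReal.ofReal (Real.exp (-(1 / (2 * η))) * Real.exp (-((1 + η * h ^ 2) *
        (frobSq (E * x * B) / (4 * σ ^ 2))))) ∂gaussianMatrix n p 1 := by
    intro h
    have hτ : 1 ≤ 1 + η * h ^ 2 := le_add_of_nonneg_right (by positivity)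
    rw [← ofReal_integral_eq_lintegral_ofReal ((hbdd (by linarith)).const_mul _)
      (Filter.Eventually.of_forall fun x => by positivity), integral_const_mul]
    refine ENNReal.ofReal_le_ofReal (mul_le_mul_of_nonneg_left ?_ (Real.exp_nonneg _))
    have hpow : ∀ t : ℝ, Real.exp (-t) ^ (1 + η * h ^ 2) = Real.exp (-((1 + η * h ^ 2) * t)) :=
      fun t => by rw [← Real.exp_mul]; congr 1; ring
    have hb1 := hbdd zero_le_one
    simp only [one_mul] at hb1
    -- Jensen for the power `1 + η h² ≥ 1`: only the first exponential moment of the squared row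
    -- difference is needed.
    have hj := (convexOn_rpow hτ).map_integral_le (μ := gaussianMatrix n p 1)
      (f := fun x => Real.exp (-(frobSq (E * x * B) / (4 * σ ^ 2))))
      (Real.continuous_rpow_const (by linarith)).continuousOn isClosed_Ici
      (Filter.Eventually.of_forall fun x => Real.exp_nonneg _) hb1 (by
        simp only [Function.comp_def, hpow]
        exact hbdd (by linarith))
    rw [integral_exp_neg_frobSq_mul B hσ E hE, hpow] at hj
    simpa only [hpow] using hj
  refine le_trans (le_of_eq ?_) (lintegral_mono hinner)
  have hint : Integrable (fun h : ℝ => Real.exp (-(η * L * h ^ 2 / 2))) (gaussianReal 0 1) :=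
    Integrable.of_bound (by fun_prop) 1 (Filter.Eventually.of_forall fun h => by
        rw [Real.norm_of_nonneg (Real.exp_nonneg _), Real.exp_le_one_iff]
        have : 0 ≤ η * L * h ^ 2 := by positivity
        linarith)
  rw [← integral_exp_neg_mul_sq_gaussianReal (mul_nonneg hη.le hL0), ← integral_const_mul,
    ← integral_const_mul, ofReal_integral_eq_lintegral_ofReal ((hint.const_mul _).const_mul _)
      (Filter.Eventually.of_forall fun x => by positivity)]
  refine lintegral_congr fun h => ?_
  rw [← Real.exp_add]
  congr 3
  ring

theorem frobSq_half_permMatrix_sub {n l : ℕ} (π : Equiv.Perm (Fin n)) {i j : Fin n} (hij : i ≠ j)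
    (x : Matrix (Fin n) (Fin l) ℝ) :
    frobSq ((2 : ℝ)⁻¹ • (π.permMatrix ℝ * x - (π * Equiv.swap i j).permMatrix ℝ * x)) =
      2⁻¹ * ∑ k, (x (π i) k - x (π j) k) ^ 2 := by
  rw [Equiv.Perm.permMatrix, PEquiv.toMatrix_toPEquiv_mul, Equiv.Perm.permMatrix,
    PEquiv.toMatrix_toPEquiv_mul, frobSq_smul]
  simp only [frobSq, Matrix.sub_apply, Matrix.submatrix_apply, id, Equiv.Perm.mul_apply]
  rw [Finset.sum_eq_add i j hij]
  · simp only [Equiv.swap_apply_left, Equiv.swap_apply_right]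
    have : ∀ k, (x (π j) k - x (π i) k) ^ 2 = (x (π i) k - x (π j) k) ^ 2 := fun k => by ring
    simp only [this]
    ring
  · intro r _ hr
    simp [Equiv.swap_apply_of_ne_of_ne hr.1 hr.2]
  · simp
  · simp

/-- The two-point bound for one coordinate of the permutation. -/
theorem integral_add_integral_swap_ge {n p m : ℕ} (B : Matrix (Fin p) (Fin m) ℝ) {σ : ℝ}
    (hσ : 0 < σ) (est : PermEstimator n p m) (π : Equiv.Perm (Fin n)) {i j : Fin n} (hij : i ≠ j)
    {η : ℝ} (hη : 0 < η) :
    Real.exp (-(1 / (2 * η))) * (Real.exp (-(logDetSNR B σ / 2)) *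
        (√(1 + η * logDetSNR B σ))⁻¹) ≤
      ∫ z, (if est.toFun (z.1, response B π z.1 z.2) i ≠ π i then (1 : ℝ) else 0)
        ∂dataLaw n p m (σ ^ 2).toNNReal +
      ∫ z, (if est.toFun (z.1, response B (π * Equiv.swap i j) z.1 z.2) i ≠
          (π * Equiv.swap i j) i then (1 : ℝ) else 0) ∂dataLaw n p m (σ ^ 2).toNNReal := by
  set v := (σ ^ 2).toNNReal with hv
  have hv0 : 0 < v := toNNReal_sq_pos hσ
  have hvr : (v : ℝ) = σ ^ 2 := Real.coe_toNNReal _ (sq_nonneg σ)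
  set π' := π * Equiv.swap i j with hπ'
  have hne : π i ≠ π' i := by
    rw [hπ', Equiv.Perm.mul_apply, Equiv.swap_apply_left]
    exact fun h => hij (π.injective h)
  set g : Equiv.Perm (Fin n) → Matrix (Fin n) (Fin p) ℝ × Matrix (Fin n) (Fin m) ℝ → ℝ≥0∞ :=
    fun ρ z => ENNReal.ofReal (if est.toFun z i ≠ ρ i then (1 : ℝ) else 0) with hg
  have hgm : ∀ ρ, Measurable (g ρ) := fun ρ =>
    est.measurable_comp fun τ => ENNReal.ofReal (if τ i ≠ ρ i then (1 : ℝ) else 0)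
  have hgsum : ∀ z, 1 ≤ g π z + g π' z := by
    intro z
    by_cases h : est.toFun z i = π i
    · have h' : est.toFun z i ≠ π' i := h ▸ hne
      simp [hg, h']
    · simp [hg, h]
  have hint : ∀ ρ, ENNReal.ofReal (∫ z, (if est.toFun (z.1, response B ρ z.1 z.2) i ≠ ρ i
      then (1 : ℝ) else 0) ∂dataLaw n p m v) =
      ∫⁻ x, ∫⁻ w, g ρ (x, response B ρ x w) ∂gaussianMatrix n m v ∂gaussianMatrix n p 1 := by
    intro ρ
    rw [ofReal_integral_eq_lintegral_ofReal (est.integrable_comp B v ρ fun τ =>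
      if τ i ≠ ρ i then (1 : ℝ) else 0) (Filter.Eventually.of_forall fun z => by positivity)]
    exact lintegral_prod _ ((hgm ρ).comp
      (measurable_fst.prodMk (measurable_response B ρ))).aemeasurable
  have hnonneg : ∀ ρ, 0 ≤ ∫ z, (if est.toFun (z.1, response B ρ z.1 z.2) i ≠ ρ i
      then (1 : ℝ) else 0) ∂dataLaw n p m v := fun ρ => integral_nonneg fun z => by positivity
  refine (ENNReal.ofReal_le_ofReal_iff (add_nonneg (hnonneg π) (hnonneg π'))).1 ?_
  rw [ENNReal.ofReal_add (hnonneg π) (hnonneg π'), hint, hint]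
  -- `E * x` is the difference of the two rows of `x` that the transposition exchanges.
  set E : Matrix (Fin 1) (Fin n) ℝ :=
    Matrix.of fun _ r => (if r = π i then 1 else 0) - (if r = π j then 1 else 0) with hE
  have hEx : ∀ (x : Matrix (Fin n) (Fin p) ℝ),
      frobSq (E * x * B) = ∑ k, ((x * B) (π i) k - (x * B) (π j) k) ^ 2 := by
    intro x
    rw [Matrix.mul_assoc]
    simp [frobSq, hE, Matrix.mul_apply (M := Matrix.of _), sub_mul, Finset.sum_sub_distrib]
  have hEE : E * E.transpose = (2 : ℝ) • 1 := by
    ext a b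
    have hπij : π i ≠ π j := fun h => hij (π.injective h)
    rw [Subsingleton.elim a b]
    simp [Matrix.mul_apply, hE, mul_sub, Finset.sum_sub_distrib, hπij, hπij.symm]
    norm_num
  refine (lintegral_lintegral_exp_ge B hσ E hEE hη).trans ?_
  rw [← lintegral_add_left]
  swap
  · exact Measurable.lintegral_prod_right' (f := fun z => g π (z.1, response B π z.1 z.2))
      ((hgm π).comp (measurable_fst.prodMk (measurable_response B π)))
  refine lintegral_mono fun x => ?_
  have h := lintegral_add_lintegral_ge hv0 hη (π.permMatrix ℝ * x * B) (π'.permMatrix ℝ * x * B)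
    (g₁ := fun y => g π (x, y)) (g₂ := fun y => g π' (x, y))
    ((hgm π).comp measurable_prodMk_left) ((hgm π').comp measurable_prodMk_left)
    (fun y => hgsum (x, y))
  refine le_trans (le_of_eq ?_) h
  have e : frobSq ((2 : ℝ)⁻¹ • (π.permMatrix ℝ * x * B - π'.permMatrix ℝ * x * B)) / v / 2 =
      frobSq (E * x * B) / (4 * σ ^ 2) := by
    rw [Matrix.mul_assoc, Matrix.mul_assoc, frobSq_half_permMatrix_sub π hij, hEx, hvr]
    field_simp
    ring
  rw [e]

/-- A lower bound on the average Hamming error from transpositions of two rows. -/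
theorem average_permHamming_ge_of_two_le {n p m : ℕ} (B : Matrix (Fin p) (Fin m) ℝ) {σ : ℝ}
    (hσ : 0 < σ) (est : PermEstimator n p m) (hn : 2 ≤ n) {η : ℝ} (hη : 0 < η) :
    (n ! : ℝ) * (n / 2 * (Real.exp (-(1 / (2 * η))) * (Real.exp (-(logDetSNR B σ / 2)) *
        (√(1 + η * logDetSNR B σ))⁻¹))) ≤
      ∑ π, ∫ z, (permHamming (est.toFun (z.1, response B π z.1 z.2)) π : ℝ)
        ∂dataLaw n p m (σ ^ 2).toNNReal := by
  set v := (σ ^ 2).toNNReal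
  set c := Real.exp (-(1 / (2 * η))) * (Real.exp (-(logDetSNR B σ / 2)) *
        (√(1 + η * logDetSNR B σ))⁻¹)
  set P : Fin n → Equiv.Perm (Fin n) → ℝ := fun i π =>
    ∫ z, (if est.toFun (z.1, response B π z.1 z.2) i ≠ π i then (1 : ℝ) else 0)
      ∂dataLaw n p m v with hP
  have e : ∀ π, ∫ z, (permHamming (est.toFun (z.1, response B π z.1 z.2)) π : ℝ)
      ∂dataLaw n p m v = ∑ i, P i π := by
    intro π
    rw [hP, ← integral_finsetSum _ fun i _ => est.integrable_comp B v π fun τ =>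
      if τ i ≠ π i then (1 : ℝ) else 0]
    simp [permHamming]
  simp only [e]
  rw [Finset.sum_comm]
  have hi : ∀ i, (n ! : ℝ) * c ≤ 2 * ∑ π, P i π := by
    intro i
    have : Nontrivial (Fin n) := Fin.nontrivial_iff_two_le.2 hn
    obtain ⟨j, hj⟩ := exists_ne i
    have h := Finset.sum_le_sum fun π (_ : π ∈ Finset.univ) =>
      integral_add_integral_swap_ge B hσ est π hj.symm hη
    -- Right multiplication by the swap permutes the group, so both points of the pair have the same
    -- average error.
    have hs : ∑ π, P i (π * Equiv.swap i j) = ∑ π, P i π :=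
      Equiv.sum_comp (Equiv.mulRight (Equiv.swap i j)) (P i)
    rw [Finset.sum_add_distrib] at h
    simp only [Finset.sum_const, Finset.card_univ, Fintype.card_perm, Fintype.card_fin,
      nsmul_eq_mul] at h
    have h' : (n ! : ℝ) * c ≤ ∑ π, P i π + ∑ π, P i (π * Equiv.swap i j) := h
    linarith
  have h : ∑ _i : Fin n, (n ! : ℝ) * c ≤ 2 * ∑ i, ∑ π, P i π := by
    rw [Finset.mul_sum]
    exact Finset.sum_le_sum fun i _ => hi i
  rw [Finset.sum_const, Finset.card_univ, Fintype.card_fin, nsmul_eq_mul] at h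
  linarith

/-! ### Numerical comparison of the transposition and Fano bounds -/

/-- Reduces an estimate on the rational power `a ^ (r/s)` to a comparison of integer powers. -/
theorem exp_mul_log_le {a b c : ℝ} {r s : ℕ} (ha : 0 < a) (hb : 0 < b) (hs : 0 < s)
    (hc : c * s = r) (h : a ^ r ≤ b ^ s) : Real.exp (c * Real.log a) ≤ b := by
  rw [← Real.le_log_iff_exp_le hb]
  have h1 := Real.log_le_log (by positivity) h
  rw [Real.log_pow, Real.log_pow, ← hc] at h1
  have hs' : (0 : ℝ) < s := by exact_mod_cast hs
  nlinarith

theorem mul_log_two_le_log {a c : ℝ} {r s : ℕ} (hs : 0 < s) (hc : c * s = r)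
    (h : (2 : ℝ) ^ r ≤ a ^ s) : c * Real.log 2 ≤ Real.log a := by
  have h1 := Real.log_le_log (by positivity) h
  rw [Real.log_pow, Real.log_pow, ← hc] at h1
  have hs' : (0 : ℝ) < s := by exact_mod_cast hs
  nlinarith

theorem exp_half_ge : (1.648 : ℝ) ≤ Real.exp (1 / 2) := by
  have h := Real.sum_le_exp_of_nonneg (x := 1 / 2) (by norm_num) 5
  norm_num [Finset.sum_range_succ, Nat.factorial] at h ⊢
  linarith

theorem exp_three_fifths_ge : (1.816 : ℝ) ≤ Real.exp (3 / 5) := by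
  have h := Real.sum_le_exp_of_nonneg (x := 3 / 5) (by norm_num) 4
  norm_num [Finset.sum_range_succ, Nat.factorial] at h ⊢
  linarith

theorem exp_one_mul_le_exp (x : ℝ) : Real.exp 1 * x ≤ Real.exp x := by
  have h := Real.add_one_le_exp (x - 1)
  rw [Real.exp_sub, sub_add_cancel, le_div_iff₀ (Real.exp_pos 1)] at h
  linarith

theorem exp_neg_le_inv_sqrt {t : ℝ} (ht : 0 ≤ t) : Real.exp (-(t / 2)) ≤ (√(1 + t))⁻¹ := by
  rw [Real.exp_neg]
  refine inv_anti₀ (Real.sqrt_pos.2 (by linarith)) (Real.sqrt_le_iff.2 ⟨Real.exp_nonneg _, ?_⟩)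
  rw [← Real.exp_nat_mul]
  have := Real.add_one_le_exp t
  rw [show ((2 : ℕ) : ℝ) * (t / 2) = t by push_cast; ring]
  linarith

/-- The lower bound from transpositions dominates the Fano-type bound, by an exponential minorant
of the former. -/
theorem fano_le_transposition_of_exp_le {n L M η κ : ℝ} (hn : 0 < n) (hL : 0 ≤ L) (hM : 1 ≤ M)
    (hη : 0 < η) (hκ : 2 * κ = 1 + η)
    (h : Real.exp (2 * κ / n * Real.log M) ≤
      κ * Real.exp (1 - 1 / (2 * η)) * (Real.log M + Real.log 2)) :
    (Real.log M - n / 2 * L) / (Real.log M + Real.log 2) ≤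
      n / 2 * (Real.exp (-(1 / (2 * η))) * (Real.exp (-(L / 2)) * (√(1 + η * L))⁻¹)) := by
  have hF : 0 < Real.log M + Real.log 2 :=
    add_pos_of_nonneg_of_pos (Real.log_nonneg hM) (Real.log_pos one_lt_two)
  have hκ0 : 0 < κ := by linarith
  set y := Real.log M - n / 2 * L with hy
  rcases le_or_gt y 0 with hy0 | hy0
  · exact (div_nonpos_of_nonpos_of_nonneg hy0 hF.le).trans (by positivity)
  have h1 : Real.exp (-(κ * L)) ≤ Real.exp (-(L / 2)) * (√(1 + η * L))⁻¹ := by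
    have e : Real.exp (-(κ * L)) = Real.exp (-(L / 2)) * Real.exp (-(η * L / 2)) := by
      rw [← Real.exp_add]; congr 1; linear_combination (-(L / 2)) * hκ
    rw [e]
    exact mul_le_mul_of_nonneg_left (exp_neg_le_inv_sqrt (by positivity)) (Real.exp_nonneg _)
  set X := Real.exp (2 * κ / n * Real.log M) with hX
  have hX0 : 0 < X := Real.exp_pos _
  -- The tangent bound `e u ≤ exp u` at `u = 2κy/n` makes both sides linear in `y`, so that `L`
  -- disappears from the remaining condition `h`.
  have h2 : Real.exp 1 * (2 * κ / n * y) * X⁻¹ ≤ Real.exp (-(κ * L)) := by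
    have e : Real.exp (-(κ * L)) = Real.exp (2 * κ / n * y) * X⁻¹ := by
      rw [hX, ← Real.exp_neg, ← Real.exp_add]
      congr 1
      rw [hy]
      field_simp
      ring
    rw [e]
    exact mul_le_mul_of_nonneg_right (exp_one_mul_le_exp _) (inv_nonneg.2 hX0.le)
  calc y / (Real.log M + Real.log 2)
      ≤ κ * Real.exp (1 - 1 / (2 * η)) * y * X⁻¹ := by
        rw [div_le_iff₀ hF]
        calc y = X * y * X⁻¹ := by field_simp
          _ ≤ κ * Real.exp (1 - 1 / (2 * η)) * (Real.log M + Real.log 2) * y * X⁻¹ := by gcongr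
          _ = _ := by ring
    _ = n / 2 * (Real.exp (-(1 / (2 * η))) * (Real.exp 1 * (2 * κ / n * y) * X⁻¹)) := by
        rw [sub_eq_add_neg, Real.exp_add]
        field_simp
    _ ≤ _ := mul_le_mul_of_nonneg_left
        (mul_le_mul_of_nonneg_left (h2.trans h1) (Real.exp_nonneg _)) (by positivity)

/-- Only `L ≤ 2 log M / n` matters, as otherwise the left side is nonpositive. On that range the
square root is kept and bounded by its tangent, instead of by an exponential. -/
theorem fano_le_transposition_of_log_bounds {n L M : ℝ} (hn : 0 < n) (hL : 0 ≤ L) (hM : 1 ≤ M)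
    (hlow : 1.44 ≤ Real.log M / n) (hupp : Real.exp (Real.log M / n) ≤ 0.6 * n) :
    (Real.log M - n / 2 * L) / (Real.log M + Real.log 2) ≤
      n / 2 * (Real.exp (-(1 / (2 * 1))) * (Real.exp (-(L / 2)) * (√(1 + 1 * L))⁻¹)) := by
  have hl2 := Real.log_pos one_lt_two
  have hF : 0 < Real.log M + Real.log 2 := add_pos_of_nonneg_of_pos (Real.log_nonneg hM) hl2
  set x := Real.log M / n with hx
  have hMx : Real.log M = n * x := by rw [hx]; field_simp
  set y := Real.log M - n / 2 * L with hy
  rcases le_or_gt y 0 with hy0 | hy0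
  · exact (div_nonpos_of_nonpos_of_nonneg hy0 hF.le).trans (by positivity)
  have hLx : L ≤ 2 * x := by
    have : n * L < n * (2 * x) := by rw [hMx] at hy; linarith
    exact (lt_of_mul_lt_mul_left this hn.le).le
  have h1 : 4 / (5 + 2 * x) ≤ (√(1 + 1 * L))⁻¹ := by
    have hs : √(1 + 1 * L) ≤ (5 + 2 * x) / 4 :=
      -- Tangent of `√(1 + L)` at `L = 3`.
      Real.sqrt_le_iff.2 ⟨by linarith, by nlinarith [sq_nonneg (2 * x - 3)]⟩
    calc 4 / (5 + 2 * x) = ((5 + 2 * x) / 4)⁻¹ := by rw [inv_div]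
      _ ≤ _ := inv_anti₀ (Real.sqrt_pos.2 (by linarith)) hs
  have h2 : Real.exp 1 * (y / n) * (Real.exp x)⁻¹ ≤ Real.exp (-(L / 2)) := by
    have e : Real.exp (-(L / 2)) = Real.exp (y / n) * (Real.exp x)⁻¹ := by
      rw [← Real.exp_neg, ← Real.exp_add]
      congr 1
      rw [hy, hMx]
      field_simp
      ring
    rw [e]
    exact mul_le_mul_of_nonneg_right (exp_one_mul_le_exp _) (inv_nonneg.2 (Real.exp_nonneg _))
  have hx5 : 0 < 5 + 2 * x := by linarith
  have h3 : Real.exp x * (5 + 2 * x) ≤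
      2 * Real.exp (1 / 2) * (Real.log M + Real.log 2) := by
    have := exp_half_ge
    calc Real.exp x * (5 + 2 * x) ≤ 0.6 * n * (5 + 2 * x) := by gcongr
      _ = n * (0.6 * (5 + 2 * x)) := by ring
      -- This is where `x ≥ 1.44` is needed: it amounts to `3 ≤ 2.096 x`.
      _ ≤ n * (2 * 1.648 * x) := mul_le_mul_of_nonneg_left (by linarith) hn.le
      _ = 2 * 1.648 * (n * x) := by ring
      _ ≤ 2 * Real.exp (1 / 2) * (Real.log M + Real.log 2) := by
        rw [hMx]
        have : 0 ≤ n * x := by rw [← hMx]; exact Real.log_nonneg hM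
        gcongr
        linarith
  calc y / (Real.log M + Real.log 2)
      ≤ 2 * Real.exp (1 / 2) * y * (Real.exp x * (5 + 2 * x))⁻¹ := by
        rw [div_le_iff₀ hF]
        calc y = Real.exp x * (5 + 2 * x) * y * (Real.exp x * (5 + 2 * x))⁻¹ := by
              field_simp
          _ ≤ 2 * Real.exp (1 / 2) * (Real.log M + Real.log 2) * y *
              (Real.exp x * (5 + 2 * x))⁻¹ := by gcongr
          _ = _ := by ring
    _ = n / 2 * (Real.exp (-(1 / (2 * 1))) * (Real.exp 1 * (y / n) * (Real.exp x)⁻¹ *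
          (4 / (5 + 2 * x)))) := by
        have : Real.exp (1 / 2) = Real.exp (-(1 / (2 * 1))) * Real.exp 1 := by
          rw [← Real.exp_add]; norm_num
        rw [this]
        field_simp
        ring
    _ ≤ _ := by gcongr

/-- The induction step uses `(1 + 1/n) ^ n ≥ 2`, so the right side grows by at least `1.2 (n + 1) ≥
n + 2`. The inequality is false at `n = 6`. -/
theorem factorial_half_le {n : ℕ} (hn : 7 ≤ n) : ((n + 1)! : ℝ) / 2 ≤ (0.6 * n) ^ n := by
  induction n, hn using Nat.le_induction with
  | base => norm_num [Nat.factorial]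
  | succ n hn ih =>
    have hn0 : (7 : ℝ) ≤ n := by exact_mod_cast hn
    have hn1 : 0 ≤ 1 / (n : ℝ) := by positivity
    have hb := one_add_mul_le_pow (a := 1 / (n : ℝ)) (by linarith) n
    have hb2 : 2 * (n : ℝ) ^ n ≤ (n + 1) ^ n := by
      have e : ((n : ℝ) + 1) ^ n = (1 + 1 / n) ^ n * n ^ n := by
        rw [← mul_pow]; congr 1; field_simp
      rw [e]
      have : (n : ℝ) * (1 / n) = 1 := by field_simp
      rw [this] at hb
      gcongr
      linarith
    rw [Nat.factorial_succ]
    push_cast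
    calc ((n : ℝ) + 1 + 1) * ((n + 1)! : ℝ) / 2 = (n + 2) * (((n + 1)! : ℝ) / 2) := by ring
      _ ≤ (1.2 * (n + 1)) * (0.6 * n) ^ n := by gcongr; linarith
      _ = 0.6 ^ n * (0.6 * (n + 1)) * (2 * (n : ℝ) ^ n) := by rw [mul_pow]; ring
      _ ≤ 0.6 ^ n * (0.6 * (n + 1)) * (n + 1) ^ n := by gcongr
      _ = _ := by rw [mul_pow, pow_succ, pow_succ]; ring

theorem le_factorial_half {n : ℕ} (hn : 8 ≤ n) : (4.4 : ℝ) ^ n ≤ ((n + 1)! : ℝ) / 2 := by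
  induction n, hn using Nat.le_induction with
  | base => norm_num [Nat.factorial]
  | succ n hn ih =>
    have hn0 : (8 : ℝ) ≤ n := by exact_mod_cast hn
    rw [Nat.factorial_succ, pow_succ]
    push_cast
    have : (0 : ℝ) ≤ 4.4 ^ n := by positivity
    nlinarith

/-- For every `n ≥ 2` the bound from transpositions dominates the Fano-type bound. -/
theorem exists_fano_le_transposition {n : ℕ} (hn : 2 ≤ n) {L : ℝ} (hL : 0 ≤ L) :
    ∃ η : ℝ, 0 < η ∧ 1 - ((n : ℝ) / 2 * L + Real.log 2) / Real.log ((n + 1)! : ℕ) ≤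
      n / 2 * (Real.exp (-(1 / (2 * η))) * (Real.exp (-(L / 2)) * (√(1 + η * L))⁻¹)) := by
  have hn0 : (0 : ℝ) < n := by exact_mod_cast (by omega : 0 < n)
  have hfac : (6 : ℝ) ≤ ((n + 1)! : ℕ) := by
    exact_mod_cast (Nat.factorial_le (by omega : 3 ≤ n + 1))
  set M : ℝ := ((n + 1)! : ℝ) / 2 with hM
  have hM1 : 1 ≤ M := by rw [hM]; linarith
  have hM0 : 0 < M := by linarith
  have hlog : Real.log ((n + 1)! : ℕ) = Real.log M + Real.log 2 := by
    rw [← Real.log_mul hM0.ne' two_ne_zero, hM]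
    congr 1
    ring
  have hF : 0 < Real.log M + Real.log 2 :=
    add_pos_of_nonneg_of_pos (Real.log_nonneg hM1) (Real.log_pos one_lt_two)
  have hlhs : 1 - ((n : ℝ) / 2 * L + Real.log 2) / Real.log ((n + 1)! : ℕ) =
      (Real.log M - n / 2 * L) / (Real.log M + Real.log 2) := by
    rw [hlog]; field_simp; ring
  rw [hlhs]
  have hl2 := Real.log_two_gt_d9
  have he := exp_half_ge
  have he' := exp_three_fifths_ge
  rcases Nat.lt_or_ge n 8 with h8 | h8
  -- Here `b` bounds `M ^ (2κ/n)` from above and `c' log 2` bounds `log (n+1)!` from below; both are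
  -- certified by integer powers.
  · have small : ∀ {η κ b c c' : ℝ} {r s r' s' : ℕ}, 0 < η → 2 * κ = 1 + η →
        0 < b → 0 < s → 0 < s' → 2 * κ / n = c → c * s = r → M ^ r ≤ b ^ s →
        c' * s' = r' → (2 : ℝ) ^ r' ≤ (((n + 1)! : ℕ) : ℝ) ^ s' →
        (∀ F, c' * Real.log 2 ≤ F → b ≤ κ * Real.exp (1 - 1 / (2 * η)) * F) →
        (Real.log M - n / 2 * L) / (Real.log M + Real.log 2) ≤
          n / 2 * (Real.exp (-(1 / (2 * η))) * (Real.exp (-(L / 2)) * (√(1 + η * L))⁻¹)) := by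
      intro η κ b c c' r s r' s' hη hκ hb hs hs' hc hcs hpow hcs' hpow' hfin
      refine fano_le_transposition_of_exp_le hn0 hL hM1 hη hκ ?_
      rw [hc]
      refine (exp_mul_log_le hM0 hb hs hcs hpow).trans (hfin _ ?_)
      rw [← hlog]
      exact mul_log_two_le_log hs' hcs' hpow'
    have e1 : (1 : ℝ) - 1 / (2 * (5 / 4)) = 3 / 5 := by norm_num
    have e2 : (1 : ℝ) - 1 / (2 * 1) = 1 / 2 := by norm_num
    rcases Nat.lt_or_ge n 4 with h4 | h4
    -- For `n = 2, 3` the criterion narrowly fails at `η = 1`.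
    · refine ⟨5 / 4, by norm_num, ?_⟩
      interval_cases n
      · refine small (κ := 9 / 8) (b := 3.45) (c := 9 / 8) (c' := 5 / 2) (r := 9) (s := 8)
          (r' := 5) (s' := 2) (by norm_num) (by norm_num) (by norm_num) (by norm_num) (by norm_num)
          (by norm_num) (by norm_num) (by norm_num [hM, Nat.factorial]) (by norm_num)
          (by norm_num [Nat.factorial]) fun F hF => ?_
        rw [e1]
        nlinarith
      · refine small (κ := 9 / 8) (b := 6.45) (c := 3 / 4) (c' := 32 / 7) (r := 3) (s := 4)
          (r' := 32) (s' := 7) (by norm_num) (by norm_num) (by norm_num) (by norm_num)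
          (by norm_num) (by norm_num) (by norm_num) (by norm_num [hM, Nat.factorial]) (by norm_num)
          (by norm_num [Nat.factorial]) fun F hF => ?_
        rw [e1]
        nlinarith
    · refine ⟨1, one_pos, ?_⟩
      interval_cases n
      · refine small (κ := 1) (b := 7.75) (c := 1 / 2) (c' := 69 / 10) (r := 1) (s := 2)
          (r' := 69) (s' := 10) (by norm_num) (by norm_num) (by norm_num) (by norm_num)
          (by norm_num) (by norm_num) (by norm_num) (by norm_num [hM, Nat.factorial]) (by norm_num)
          (by norm_num [Nat.factorial]) fun F hF => ?_
        rw [e2]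
        nlinarith
      · refine small (κ := 1) (b := 10.54) (c := 2 / 5) (c' := 47 / 5) (r := 2) (s := 5)
          (r' := 47) (s' := 5) (by norm_num) (by norm_num) (by norm_num) (by norm_num)
          (by norm_num) (by norm_num) (by norm_num) (by norm_num [hM, Nat.factorial]) (by norm_num)
          (by norm_num [Nat.factorial]) fun F hF => ?_
        rw [e2]
        nlinarith
      · refine small (κ := 1) (b := 13.61) (c := 1 / 3) (c' := 49 / 4) (r := 1) (s := 3)
          (r' := 49) (s' := 4) (by norm_num) (by norm_num) (by norm_num) (by norm_num)
          (by norm_num) (by norm_num) (by norm_num) (by norm_num [hM, Nat.factorial]) (by norm_num)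
          (by norm_num [Nat.factorial]) fun F hF => ?_
        rw [e2]
        nlinarith
      · refine small (κ := 1) (b := 17) (c := 2 / 7) (c' := 61 / 4) (r := 2) (s := 7)
          (r' := 61) (s' := 4) (by norm_num) (by norm_num) (by norm_num) (by norm_num)
          (by norm_num) (by norm_num) (by norm_num) (by norm_num [hM, Nat.factorial]) (by norm_num)
          (by norm_num [Nat.factorial]) fun F hF => ?_
        rw [e2]
        nlinarith
  · refine ⟨1, one_pos, fano_le_transposition_of_log_bounds hn0 hL hM1 ?_ ?_⟩
    · rw [le_div_iff₀ hn0]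
      have h1 := Real.log_le_log (by positivity) (le_factorial_half h8)
      rw [Real.log_pow, ← hM] at h1
      have h2 : 21 / 10 * Real.log 2 ≤ Real.log 4.4 :=
        mul_log_two_le_log (r := 21) (s := 10) (by norm_num) (by norm_num) (by norm_num)
      have h3 : (1.44 : ℝ) ≤ Real.log 4.4 := by linarith
      calc 1.44 * (n : ℝ) ≤ n * Real.log 4.4 := by rw [mul_comm]; gcongr
        _ ≤ _ := h1
    · rw [← Real.le_log_iff_exp_le (by positivity), div_le_iff₀ hn0, mul_comm]
      have h1 := Real.log_le_log hM0 (factorial_half_le (by omega : 7 ≤ n))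
      rwa [Real.log_pow] at h1

/-! ### Assembling the bounds -/

theorem le_average_permHamming {n p m : ℕ} (B : Matrix (Fin p) (Fin m) ℝ) {σ : ℝ}
    (hσ : 0 < σ) (est : PermEstimator n p m) {d : ℕ} (hd : d < n) :
    (n ! : ℝ) * (((d : ℝ) + 1) *
      (1 - ((n : ℝ) / 2 * logDetSNR B σ + Real.log 2) / Real.log ((n - d + 1)! : ℕ))) ≤
      ∑ π, ∫ z, (permHamming (est.toFun (z.1, response B π z.1 z.2)) π : ℝ)
        ∂dataLaw n p m (σ ^ 2).toNNReal := by
  have hL := logDetSNR_nonneg B hσ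
  have hl2 := Real.log_pos one_lt_two
  rcases eq_or_ne (d + 1) n with hdn | hdn
  -- For `d = n - 1` the denominator is `log 2`, so the claimed bound is at most zero.
  · have e : ((n - d + 1)! : ℕ) = 2 := by rw [← hdn]; simp
    have h1 : 1 - ((n : ℝ) / 2 * logDetSNR B σ + Real.log 2) / Real.log ((n - d + 1)! : ℕ) ≤ 0 := by
      rw [e, sub_nonpos, Nat.cast_two, one_le_div hl2]
      exact le_add_of_nonneg_left (by positivity)
    exact (mul_nonpos_of_nonneg_of_nonpos (Nat.cast_nonneg _)
      (mul_nonpos_of_nonneg_of_nonpos (by positivity) h1)).trans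
      (Finset.sum_nonneg fun π _ => integral_nonneg fun z => Nat.cast_nonneg _)
  · rcases Nat.eq_zero_or_pos d with rfl | hd0
    -- For `d = 0` the exponential moment would have to be at most `2/(n+1) < 1`, but `π = τ` alone
    -- contributes `1`; transpositions are used instead.
    · have hn : 2 ≤ n := by omega
      obtain ⟨η, hη, h⟩ := exists_fano_le_transposition hn hL
      refine le_trans ?_ (average_permHamming_ge_of_two_le B hσ est hn hη)
      refine mul_le_mul_of_nonneg_left ?_ (Nat.cast_nonneg _)
      simpa using h
    · exact le_average_permHamming_of_pos B hσ est hd0 (by omega)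

theorem corollary1 (n p m : ℕ) (B : Matrix (Fin p) (Fin m) ℝ) (σ : ℝ) (hσ : 0 < σ) :
    (∀ D : ℕ, D ≤ n →
      logDetSNR B σ ≤ (Real.log ((n - D + 1)! : ℕ) - Real.log 4) / n →
      1 / 2 ≤ minimaxPermRisk n B σ (fun πhat π => if D ≤ permHamming πhat π then 1 else 0)) ∧
    (∀ d : ℕ, d < n →
      ENNReal.ofReal
        (((d : ℝ) + 1) *
          (1 - ((n : ℝ) / 2 * logDetSNR B σ + Real.log 2) / Real.log ((n - d + 1)! : ℕ))) ≤
      minimaxPermRisk n B σ (fun πhat π => (permHamming πhat π : ℝ≥0∞))) := by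

  refine ⟨fun D hD h => half_le_minimaxPermRisk B hσ hD h, fun d hd => ?_⟩
  exact ofReal_le_minimaxPermRisk B σ (f := fun τ π => (permHamming τ π : ℝ))
    (fun _ _ => Nat.cast_nonneg _) (fun _ _ => (ENNReal.ofReal_natCast _).symm)
    fun est => le_average_permHamming B hσ est hd
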